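/- Let $\mu$ be either the Lebesgue measure on $\mathbb R$ or the standard Gaussian measure $d\gamma(t)=(2\pi)^{-1/2}e^{-t^2/2}\,dt$ on $\mathbb R$, and let $\mu_2=\mu\otimes\mu$ on $\mathbb R^2$. If a random vector $Z$ has density $f$ with respect to a measure $\nu$, its $\nu$-entropy is $S_\nu(Z)=\int f\log f\,d\nu$; it is called finite if $f\log f$ is $\nu$-integrable. Let $p_1,p_2,p_3>1$ satisfy $\frac1{p_1}+\frac1{p_2}+\frac1{p_3}=2$. Then there are unique angles $\theta_2,\theta_3\in(0,\pi)$ such that $$(\cos\theta_2,\sin\theta_2)=\Big(\sqrt{(p_1-1)(p_2-1)},\ \sqrt{\tfrac{p_1p_2(p_3-1)}{p_3}}\Big),\qquad (\cos\theta_3,\sin\theta_3)=\Big(-\sqrt{(p_1-1)(p_3-1)},\ \sqrt{\tfrac{p_1p_3(p_2-1)}{p_2}}\Big),$$ and the following two (dual) statements hold. (1) For all real random variables $X,Y$ on a common probability space such that $(X,Y)$ has finite $\mu_2$-entropy and $X$, $\cos(\theta_2)X+\sin(\theta_2)Y$, $\cos(\theta_3)X+\sin(\theta_3)Y$ have finite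 $\mu$-entropy, $$\frac1{p_1}S_\mu(X)+\frac1{p_2}S_\mu\big(\cos(\theta_2)X+\sin(\theta_2)Y\big)+\frac1{p_3}S_\mu\big(\cos(\theta_3)X+\sin(\theta_3)Y\big)\le S_{\mu_2}(X,Y),$$ with equality if and only if $X$ and $Y$ are independent (non-degenerate) Gaussian variables with the same variance (their means may differ). (2) For all real functions $g\in L^{p_2}(\mu)$ and $h\in L^{p_3}(\mu)$, with $p_1'=\frac{p_1}{p_1-1}$, the integral $$T(g,h)(x)=\int g\big(\cos(\theta_2)x+\sin(\theta_2)y\big)\,h\big(\cos(\theta_3)x+\sin(\theta_3)y\big)\,d\mu(y)$$ converges absolutely for $\mu$-almost every $x$, the function $T(g,h)$ belongs to $L^{p_1'}(\mu)$, and $$\|T(g,h)\|_{L^{p_1'}(\mu)}\le\|g\|_{L^{p_2}(\mu)}\,\|h\|_{L^{p_3}(\mu)}.$$ Equality holds if and only if $g=0$ $\mu$-a.e., or $h=0$ $\mu$-a.e., or $g$ and $h$ are each of constant sign ($\mu$-a.e.) and there are $K_2,K_3,\lambda>0$ and $a_2,a_3\in\mathbb R$ with $$|g(t)|^{p_2}\,d\mu(t)=K_2e^{-\lambda(t-a_2)^2}\,dt\quad\text{and}\quad|h(t)|^{p_3}\,d\mu(t)=K_3e^{-\lambda(t-a_3)^2}\,dt.$$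 -/

import Mathlib

open MeasureTheory ProbabilityTheory

/-- The entropy `S_ν(X) = ∫ f log f dν` of a random vector `X` with density `f` with respect
to the reference measure `ν`. -/
noncomputable def relEntropy {Ω E : Type*} [MeasurableSpace Ω] [MeasurableSpace E]
    (X : Ω → E) (P : Measure Ω) (ν : Measure E) : ℝ :=
  ∫ x, (pdf X P ν x).toReal * Real.log (pdf X P ν x).toReal ∂ν

/-- `X` has a density `f` with respect to `ν`, and its entropy with respect to `ν` is well defined
and finite, i.e. `f log f` is `ν`-integrable. -/
def HasFiniteEntropy {Ω E : Type*} [MeasurableSpace Ω] [MeasurableSpace E]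
    (X : Ω → E) (P : Measure Ω) (ν : Measure E) : Prop :=
  HasPDF X P ν ∧
    Integrable (fun x => (pdf X P ν x).toReal * Real.log (pdf X P ν x).toReal) ν

/-- `θ ∈ ]0, π[` is the angle with
`(cos θ, sin θ) = (√((p₁-1)(p₂-1)), √(p₁ p₂ (p₃-1) / p₃))`. -/
def IsSecondAngle (p₁ p₂ p₃ θ : ℝ) : Prop :=
  θ ∈ Set.Ioo 0 Real.pi ∧
    Real.cos θ = √((p₁ - 1) * (p₂ - 1)) ∧
    Real.sin θ = √(p₁ * p₂ * (p₃ - 1) / p₃)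

/-- `θ ∈ ]0, π[` is the angle with
`(cos θ, sin θ) = (-√((p₁-1)(p₃-1)), √(p₁ p₃ (p₂-1) / p₂))`. -/
def IsThirdAngle (p₁ p₂ p₃ θ : ℝ) : Prop :=
  θ ∈ Set.Ioo 0 Real.pi ∧
    Real.cos θ = -√((p₁ - 1) * (p₃ - 1)) ∧
    Real.sin θ = √(p₁ * p₃ * (p₂ - 1) / p₂)

/-- The function `x ↦ ∫ g(cos θ₂ x + sin θ₂ y) h(cos θ₃ x + sin θ₃ y) dμ(y)`. -/
noncomputable def angleConv (μ : Measure ℝ) (θ₂ θ₃ : ℝ) (g h : ℝ → ℝ) (x : ℝ) : ℝ :=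
  ∫ y, g (Real.cos θ₂ * x + Real.sin θ₂ * y) * h (Real.cos θ₃ * x + Real.sin θ₃ * y) ∂μ

/-- `g` is `μ`-almost everywhere nonnegative or `μ`-almost everywhere nonpositive. -/
def HasConstantSign (μ : Measure ℝ) (g : ℝ → ℝ) : Prop :=
  (∀ᵐ t ∂μ, 0 ≤ g t) ∨ (∀ᵐ t ∂μ, g t ≤ 0)

/-- The equality of measures `|g(t)|^p dμ(t) = K e^{-lam (t-a)²} dt`. -/
def PowIsGaussian (μ : Measure ℝ) (g : ℝ → ℝ) (p K lam a : ℝ) : Prop :=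
  μ.withDensity (fun t => ENNReal.ofReal (|g t| ^ p)) =
    (volume : Measure ℝ).withDensity
      (fun t => ENNReal.ofReal (K * Real.exp (-lam * (t - a) ^ 2)))

/-! The angles are chosen so that the unit vectors `u₁ = (1, 0)`, `u₂`, `u₃` at angles 0, θ₂, θ₃,
with weights `cᵢ = 1 / pᵢ`, decompose the identity: `∑ cᵢ uᵢ ⊗ uᵢ = Id`. Both statements then follow
from the geometric Brascamp-Lieb inequality `∫ ∏ fᵢ(uᵢ·z) ^ cᵢ ≤ ∏ (∫ fᵢ) ^ cᵢ` and its equality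
cases (`TightFrame.lintegral_product_le_one`).

That inequality is proved by mass transport. Let `Tᵢ` be the monotone map carrying the probability
density `fᵢ` to the standard Gaussian density `φ`, so that `fᵢ = Tᵢ' · φ(Tᵢ)`, and let `Θ(z) = ∑ cᵢ
Tᵢ(uᵢ·z) uᵢ`. The map is injective. The factors `Tᵢ'` are controlled by `∏ tᵢ ^ cᵢ ≤ det (∑ cᵢ tᵢ uᵢ
⊗ uᵢ)` (`prod_rpow_le_det`), the Gaussian factors by `∑ cᵢ tᵢ² = |θ|² + defect` with `θ = ∑ cᵢ tᵢ
uᵢ` (`prod_stdGaussian_rpow`). A change of variables bounds the integral by the mass of the Gaussian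
plane. Equality makes the defect vanish almost everywhere; the linear relation between the `uᵢ` then
becomes a Pexider equation for the monotone inverses of the `Tᵢ`, so these are affine with a common
slope and the `fᵢ` are Gaussian with a common variance.

Gaussian and Lebesgue measure are treated together: either density `w` satisfies `∏ w(uᵢ·z) ^ cᵢ =
w(z₁) w(z₂)`, so each `fᵢ` may be replaced by `w fᵢ` (`IsWeight`).

The convolution inequality is dual: freezing `f₂` and `f₃` gives a bound on `∫ f ^ c₁ · T(g, h)` for
all `f`, hence on an `L^{p₁'}` norm. Signs in the equality case are handled by a multiplicative
analogue of the Pexider argument. The entropy inequality comes from `log r ≤ r - 1`, where `r` is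
the quotient of the Brascamp-Lieb integrand, evaluated at the densities of the three projections, by
the joint density. -/

/-! ### Null sets under linear and affine maps -/

theorem quasiMeasurePreserving_linearForm {a b : ℝ} (h : a ≠ 0 ∨ b ≠ 0) :
    Measure.QuasiMeasurePreserving (fun z : ℝ × ℝ => a * z.1 + b * z.2) volume volume := by
  refine ⟨by fun_prop, ?_⟩
  let L : ℝ × ℝ →ₗ[ℝ] ℝ := a • LinearMap.fst ℝ ℝ ℝ + b • LinearMap.snd ℝ ℝ ℝ
  have hL : Function.Surjective L := by
    intro t
    rcases h with h | h
    · exact ⟨(t / a, 0), by simp [L]; field_simp⟩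
    · exact ⟨(0, t / b), by simp [L]; field_simp⟩
  obtain ⟨c, -, hc⟩ := L.exists_map_addHaar_eq_smul_addHaar volume (volume : Measure ℝ) hL
  have : (fun z : ℝ × ℝ => a * z.1 + b * z.2) = L := by ext z; simp [L]
  rw [this, hc]
  exact Measure.smul_absolutelyContinuous

theorem quasiMeasurePreserving_linearPair {a b c d : ℝ} (h : a * d - b * c ≠ 0) :
    Measure.QuasiMeasurePreserving
      (fun z : ℝ × ℝ => (a * z.1 + b * z.2, c * z.1 + d * z.2)) volume volume := by
  let L : ℝ × ℝ →ₗ[ℝ] ℝ × ℝ := Matrix.toLin (.finTwoProd ℝ) (.finTwoProd ℝ) !![a, b; c, d]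
  have hL : LinearMap.det L ≠ 0 := by
    simpa [L, LinearMap.det_toLin, Matrix.det_fin_two_of] using h
  have : (fun z : ℝ × ℝ => (a * z.1 + b * z.2, c * z.1 + d * z.2)) = L := by
    ext z <;> simp [L, Matrix.toLin_finTwoProd_apply]
  rw [this]
  exact Measure.LinearMap.quasiMeasurePreserving volume L hL

theorem quasiMeasurePreserving_affine {a : ℝ} (b : ℝ) (ha : a ≠ 0) :
    Measure.QuasiMeasurePreserving (fun y : ℝ => b + a * y) volume volume := by
  have h1 : Measure.QuasiMeasurePreserving (fun y : ℝ => a * y) volume volume := by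
    simpa using Measure.quasiMeasurePreserving_smul (volume : Measure ℝ) ha
  exact (measurePreserving_add_left volume b).quasiMeasurePreserving.comp h1

/-! ### Tight frames of three vectors in the plane -/

/-- Weighted unit vectors `(1, 0)`, `(C₂, S₂)`, `(C₃, S₃)` of the plane that decompose the identity:
`c₁ u₁ ⊗ u₁ + c₂ u₂ ⊗ u₂ + c₃ u₃ ⊗ u₃ = Id`. -/
structure TightFrame where
  (c₁ c₂ c₃ C₂ S₂ C₃ S₃ : ℝ)
  c₁_pos : 0 < c₁
  c₂_pos : 0 < c₂
  c₃_pos : 0 < c₃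
  c₁_lt_one : c₁ < 1
  c₂_lt_one : c₂ < 1
  c₃_lt_one : c₃ < 1
  S₂_pos : 0 < S₂
  S₃_pos : 0 < S₃
  C₂_pos : 0 < C₂
  C₃_neg : C₃ < 0
  unit₂ : C₂ ^ 2 + S₂ ^ 2 = 1
  unit₃ : C₃ ^ 2 + S₃ ^ 2 = 1
  diag₁ : c₁ + c₂ * C₂ ^ 2 + c₃ * C₃ ^ 2 = 1
  offdiag : c₂ * C₂ * S₂ + c₃ * C₃ * S₃ = 0
  diag₂ : c₂ * S₂ ^ 2 + c₃ * S₃ ^ 2 = 1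

namespace TightFrame

variable (F : TightFrame)

/-- The coordinate along `(C₂, S₂)`. -/
def u₂ (z : ℝ × ℝ) : ℝ := F.C₂ * z.1 + F.S₂ * z.2

/-- The coordinate along `(C₃, S₃)`. -/
def u₃ (z : ℝ × ℝ) : ℝ := F.C₃ * z.1 + F.S₃ * z.2

/-- The determinant of the second and third vectors. -/
def D : ℝ := F.C₂ * F.S₃ - F.S₂ * F.C₃

theorem D_pos : 0 < F.D := by
  have h1 := mul_pos F.C₂_pos F.S₃_pos
  have h2 := mul_pos F.S₂_pos (neg_pos.2 F.C₃_neg)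
  unfold D; linarith

@[fun_prop] theorem measurable_u₂ : Measurable F.u₂ := by unfold u₂; fun_prop
@[fun_prop] theorem measurable_u₃ : Measurable F.u₃ := by unfold u₃; fun_prop

/-- Cramer's rule, that is, the linear relation `D u₁ = S₃ u₂ - S₂ u₃`. It is the source of the
functional equation in the equality case. -/
theorem D_mul_fst (z : ℝ × ℝ) : F.D * z.1 = F.S₃ * F.u₂ z - F.S₂ * F.u₃ z := by
  unfold D u₂ u₃; ring

theorem qmp_u₂ : Measure.QuasiMeasurePreserving F.u₂ volume volume :=
  quasiMeasurePreserving_linearForm (Or.inl F.C₂_pos.ne')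

theorem qmp_u₃ : Measure.QuasiMeasurePreserving F.u₃ volume volume :=
  quasiMeasurePreserving_linearForm (Or.inl F.C₃_neg.ne)

/-- The trace of the decomposition of the identity. -/
theorem sum_c : F.c₁ + F.c₂ + F.c₃ = 2 := by
  linear_combination F.diag₁ + F.diag₂ - F.c₂ * F.unit₂ - F.c₃ * F.unit₃

/-- The decomposition of the identity read as a quadratic form; this is what makes Gaussians
multiplicative along the frame. -/
theorem sq_add_sq (z : ℝ × ℝ) :
    F.c₁ * z.1 ^ 2 + F.c₂ * F.u₂ z ^ 2 + F.c₃ * F.u₃ z ^ 2 = z.1 ^ 2 + z.2 ^ 2 := by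
  unfold u₂ u₃
  linear_combination z.1 ^ 2 * F.diag₁ + 2 * z.1 * z.2 * F.offdiag + z.2 ^ 2 * F.diag₂

/-- This and the next two identities compute `cᵢ cⱼ det(uᵢ, uⱼ)²`, the coefficients in the
Cauchy-Binet expansion of `det (∑ cᵢ tᵢ uᵢ ⊗ uᵢ)`. -/
theorem c_mul_c₁₂ : F.c₁ * F.c₂ * F.S₂ ^ 2 = 1 - F.c₃ := by
  have h1 := F.diag₁; have h2 := F.offdiag; have h3 := F.diag₂; have h4 := F.unit₃
  -- `det (Id - c₃ u₃ ⊗ u₃) = 1 - c₃`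
  have e1 : F.c₁ + F.c₂ * F.C₂ ^ 2 = 1 - F.c₃ * F.C₃ ^ 2 := by linarith
  have e2 : F.c₂ * F.S₂ ^ 2 = 1 - F.c₃ * F.S₃ ^ 2 := by linarith
  have e3 : F.c₂ * F.C₂ * F.S₂ = - (F.c₃ * F.C₃ * F.S₃) := by linarith
  have : (F.c₁ + F.c₂ * F.C₂ ^ 2) * (F.c₂ * F.S₂ ^ 2) - (F.c₂ * F.C₂ * F.S₂) ^ 2
      = F.c₁ * F.c₂ * F.S₂ ^ 2 := by ring
  rw [← this, e1, e2, e3]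
  linear_combination (-F.c₃) * h4

theorem c_mul_c₁₃ : F.c₁ * F.c₃ * F.S₃ ^ 2 = 1 - F.c₂ := by
  have h1 := F.diag₁; have h2 := F.offdiag; have h3 := F.diag₂; have h4 := F.unit₂
  have e1 : F.c₁ + F.c₃ * F.C₃ ^ 2 = 1 - F.c₂ * F.C₂ ^ 2 := by linarith
  have e2 : F.c₃ * F.S₃ ^ 2 = 1 - F.c₂ * F.S₂ ^ 2 := by linarith
  have e3 : F.c₃ * F.C₃ * F.S₃ = - (F.c₂ * F.C₂ * F.S₂) := by linarith
  have : (F.c₁ + F.c₃ * F.C₃ ^ 2) * (F.c₃ * F.S₃ ^ 2) - (F.c₃ * F.C₃ * F.S₃) ^ 2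
      = F.c₁ * F.c₃ * F.S₃ ^ 2 := by ring
  rw [← this, e1, e2, e3]
  linear_combination (-F.c₂) * h4

theorem c_mul_c₂₃ : F.c₂ * F.c₃ * F.D ^ 2 = 1 - F.c₁ := by
  have e1 : F.c₂ * F.C₂ ^ 2 + F.c₃ * F.C₃ ^ 2 = 1 - F.c₁ := by linarith [F.diag₁]
  have : (F.c₂ * F.C₂ ^ 2 + F.c₃ * F.C₃ ^ 2) * (F.c₂ * F.S₂ ^ 2 + F.c₃ * F.S₃ ^ 2)
      - (F.c₂ * F.C₂ * F.S₂ + F.c₃ * F.C₃ * F.S₃) ^ 2 = F.c₂ * F.c₃ * F.D ^ 2 := by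
    unfold D; ring
  rw [← this, e1, F.diag₂, F.offdiag]; ring

/-- `∏ tᵢ ^ cᵢ ≤ det (∑ cᵢ tᵢ uᵢ ⊗ uᵢ)`. -/
theorem prod_rpow_le_det {t₁ t₂ t₃ : ℝ} (h₁ : 0 < t₁) (h₂ : 0 < t₂) (h₃ : 0 < t₃) :
    t₁ ^ F.c₁ * t₂ ^ F.c₂ * t₃ ^ F.c₃ ≤
      (F.c₁ * t₁ + F.c₂ * F.C₂ ^ 2 * t₂ + F.c₃ * F.C₃ ^ 2 * t₃)
        * (F.c₂ * F.S₂ ^ 2 * t₂ + F.c₃ * F.S₃ ^ 2 * t₃)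
      - (F.c₂ * F.C₂ * F.S₂ * t₂ + F.c₃ * F.C₃ * F.S₃ * t₃)
        * (F.c₂ * F.C₂ * F.S₂ * t₂ + F.c₃ * F.C₃ * F.S₃ * t₃) := by
  -- By Cauchy-Binet the determinant is `(1 - c₃) t₁t₂ + (1 - c₂) t₁t₃ + (1 - c₁) t₂t₃`. The weights
  -- add up to `3 - 2 = 1`, and in the geometric mean `t₁` has exponent `2 - c₂ - c₃ = c₁`, and
  -- likewise for the others.
  have key := Real.geom_mean_le_arith_mean3_weighted (w₁ := 1 - F.c₃) (w₂ := 1 - F.c₂)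
    (w₃ := 1 - F.c₁) (p₁ := t₁ * t₂) (p₂ := t₁ * t₃) (p₃ := t₂ * t₃)
    (by linarith [F.c₃_lt_one]) (by linarith [F.c₂_lt_one]) (by linarith [F.c₁_lt_one])
    (by positivity) (by positivity) (by positivity) (by linarith [F.sum_c])
  have e1 : t₁ ^ F.c₁ = t₁ ^ (1 - F.c₃) * t₁ ^ (1 - F.c₂) := by
    rw [← Real.rpow_add h₁]; congr 1; linarith [F.sum_c]
  have e2 : t₂ ^ F.c₂ = t₂ ^ (1 - F.c₃) * t₂ ^ (1 - F.c₁) := by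
    rw [← Real.rpow_add h₂]; congr 1; linarith [F.sum_c]
  have e3 : t₃ ^ F.c₃ = t₃ ^ (1 - F.c₂) * t₃ ^ (1 - F.c₁) := by
    rw [← Real.rpow_add h₃]; congr 1; linarith [F.sum_c]
  rw [Real.mul_rpow h₁.le h₂.le, Real.mul_rpow h₁.le h₃.le, Real.mul_rpow h₂.le h₃.le] at key
  calc _ = t₁ ^ (1 - F.c₃) * t₂ ^ (1 - F.c₃) * (t₁ ^ (1 - F.c₂) * t₃ ^ (1 - F.c₂))
        * (t₂ ^ (1 - F.c₁) * t₃ ^ (1 - F.c₁)) := by rw [e1, e2, e3]; ring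
    _ ≤ _ := key
    _ = _ := by
      rw [← F.c_mul_c₁₂, ← F.c_mul_c₁₃, ← F.c_mul_c₂₃]; unfold D; ring

end TightFrame

/-! ### Monotone transport to the standard Gaussian -/

open Filter Topology Set in
theorem hasDerivAt_cdf_gaussianReal (t : ℝ) :
    HasDerivAt (cdf (gaussianReal 0 1)) (gaussianPDFReal 0 1 t) t := by
  have hc : Continuous (gaussianPDFReal 0 1) := by
    unfold gaussianPDFReal; fun_prop
  have hint := integrable_gaussianPDFReal 0 1
  have e : ∀ x, cdf (gaussianReal 0 1) x
      = cdf (gaussianReal 0 1) 0 + ∫ y in (0 : ℝ)..x, gaussianPDFReal 0 1 y := by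
    intro x
    have h : ∀ x, cdf (gaussianReal 0 1) x = ∫ y in Iic x, gaussianPDFReal 0 1 y := by
      intro x
      rw [cdf_eq_real, measureReal_def, gaussianReal_apply_eq_integral _ one_ne_zero,
        ENNReal.toReal_ofReal]
      exact integral_nonneg fun y => gaussianPDFReal_nonneg _ _ _
    rw [h, h, ← intervalIntegral.integral_Iic_sub_Iic hint.integrableOn hint.integrableOn]
    ring
  rw [funext e]
  exact (intervalIntegral.integral_hasDerivAt_right (hint.intervalIntegrable)
    (hc.stronglyMeasurableAtFilter _ _) hc.continuousAt).const_add _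

theorem continuous_cdf_gaussianReal : Continuous (cdf (gaussianReal 0 1)) :=
  continuous_iff_continuousAt.2 fun t => (hasDerivAt_cdf_gaussianReal t).continuousAt

theorem strictMono_cdf_gaussianReal : StrictMono (cdf (gaussianReal 0 1)) :=
  strictMono_of_hasDerivAt_pos hasDerivAt_cdf_gaussianReal
    fun _ => gaussianPDFReal_pos _ _ _ one_ne_zero

theorem cdf_gaussianReal_mem_Ioo (t : ℝ) : cdf (gaussianReal 0 1) t ∈ Set.Ioo (0 : ℝ) 1 :=
  ⟨(cdf_nonneg _ (t - 1)).trans_lt (strictMono_cdf_gaussianReal (by linarith)),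
    (strictMono_cdf_gaussianReal (show t < t + 1 by linarith)).trans_le (cdf_le_one _ _)⟩

open Filter Topology Set in
theorem exists_gaussian_quantile : ∃ Q : ℝ → ℝ, ∀ s ∈ Ioo (0 : ℝ) 1,
    cdf (gaussianReal 0 1) (Q s) = s ∧ HasDerivAt Q (gaussianPDFReal 0 1 (Q s))⁻¹ s := by
  have h : ∀ s ∈ Ioo (0 : ℝ) 1, ∃ t, cdf (gaussianReal 0 1) t = s := by
    intro s hs
    refine mem_range_of_exists_le_of_exists_ge continuous_cdf_gaussianReal ?_ ?_
    · exact ((tendsto_cdf_atBot (gaussianReal 0 1)).eventually_le_const hs.1).exists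
    · exact ((tendsto_cdf_atTop (gaussianReal 0 1)).eventually_const_le hs.2).exists
  choose! Q hQ using h
  refine ⟨Q, fun s hs => ⟨hQ s hs, ?_⟩⟩
  -- A monotone function whose image is the whole line cannot jump; this gives the continuity needed
  -- by the inverse function rule.
  have hmono : StrictMonoOn Q (Ioo 0 1) := by
    intro a ha b hb hab
    rw [← strictMono_cdf_gaussianReal.lt_iff_lt, hQ a ha, hQ b hb]
    exact hab
  have himg : Q '' Ioo 0 1 = univ := by
    refine eq_univ_of_forall fun t => ⟨_, cdf_gaussianReal_mem_Ioo t, ?_⟩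
    exact strictMono_cdf_gaussianReal.injective (hQ _ (cdf_gaussianReal_mem_Ioo t))
  have hnhds : Ioo (0 : ℝ) 1 ∈ 𝓝 s := Ioo_mem_nhds hs.1 hs.2
  have hcont : ContinuousAt Q s :=
    hmono.continuousAt_of_image_mem_nhds hnhds (by rw [himg]; exact univ_mem)
  exact (hasDerivAt_cdf_gaussianReal _).of_local_left_inverse hcont
    (gaussianPDFReal_pos _ _ _ one_ne_zero).ne' (by filter_upwards [hnhds] with y hy using hQ y hy)

/-- `T` is the monotone map, defined on a set `A` carrying the density `f`, that transports `f`
to the standard Gaussian density; `S` is a monotone left inverse of it. -/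
structure IsGaussianTransport (f : ℝ → ENNReal) (A : Set ℝ) (T S : ℝ → ℝ) : Prop where
  measurableSet : MeasurableSet A
  ae_eq_zero : ∀ᵐ t, t ∉ A → f t = 0
  pos : ∀ t ∈ A, 0 < (f t).toReal
  strictMonoOn : StrictMonoOn T A
  hasDerivAt : ∀ t ∈ A, HasDerivAt T ((f t).toReal / gaussianPDFReal 0 1 (T t)) t
  monotone : Monotone S
  leftInv : ∀ t ∈ A, S (T t) = t
  eq_gaussian_of_affine : ∀ k m : ℝ, (∀ t, S t = k * t + m) →
    0 < k ∧ (volume : Measure ℝ).withDensity f = gaussianReal m (k ^ 2).toNNReal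

open Filter Topology Set in
-- If `F` took the same value at `a` and `b` it would be constant in between, and its one-sided
-- derivative at `a` would be 0.
theorem lt_of_hasDerivAt_pos_of_monotone {F : ℝ → ℝ} (hF : Monotone F) {a d : ℝ}
    (hd : HasDerivAt F d a) (hpos : 0 < d) :
    (∀ b, a < b → F a < F b) ∧ ∀ b, b < a → F b < F a := by
  constructor
  · intro b hab
    refine lt_of_le_of_ne (hF hab.le) fun heq => hpos.ne' ?_
    have h1 : HasDerivWithinAt F d (Icc a b) a := hd.hasDerivWithinAt
    have h2 : HasDerivWithinAt F 0 (Icc a b) a :=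
      (hasDerivWithinAt_const a (Icc a b) (F a)).congr
        (fun x hx => le_antisymm (heq ▸ hF hx.2) (hF hx.1)) rfl
    exact (uniqueDiffOn_Icc hab a (left_mem_Icc.2 hab.le)).eq_deriv _ h1 h2
  · intro b hab
    refine lt_of_le_of_ne (hF hab.le) fun heq => hpos.ne' ?_
    have h1 : HasDerivWithinAt F d (Icc b a) a := hd.hasDerivWithinAt
    have h2 : HasDerivWithinAt F 0 (Icc b a) a :=
      (hasDerivWithinAt_const a (Icc b a) (F a)).congr
        (fun x hx => le_antisymm (hF hx.2) (heq ▸ hF hx.1)) rfl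
    exact (uniqueDiffOn_Icc hab a (right_mem_Icc.2 hab.le)).eq_deriv _ h1 h2

open Filter Topology Set in
-- The transport is `Q ∘ F`, with `F` the distribution function of `f` and `Q` the Gaussian
-- quantile. Its inverse is taken as a generalized inverse, so that it is defined and monotone on
-- the whole line, as the functional equation requires.
theorem exists_isGaussianTransport {f : ℝ → ENNReal} (hf : Measurable f)
    (hf1 : ∫⁻ t, f t = 1) : ∃ A T S, IsGaussianTransport f A T S := by
  obtain ⟨Q, hQ⟩ := exists_gaussian_quantile
  set ν : Measure ℝ := (volume : Measure ℝ).withDensity f with hν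
  have hprob : IsProbabilityMeasure ν := ⟨by rw [hν, withDensity_apply _ .univ]; simpa using hf1⟩
  set F : ℝ → ℝ := ⇑(cdf ν) with hF
  have hFm : Monotone F := monotone_cdf ν
  set Φ : ℝ → ℝ := ⇑(cdf (gaussianReal 0 1)) with hΦ
  -- The points where `F` has derivative `f > 0`; by Lebesgue differentiation `f` vanishes almost
  -- everywhere off this set.
  let A : Set ℝ := {t | DifferentiableAt ℝ F t} ∩ {t | deriv F t = (f t).toReal}
    ∩ {t | 0 < (f t).toReal}
  have hAd : ∀ t ∈ A, HasDerivAt F (f t).toReal t := by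
    rintro t ⟨⟨h1, h2⟩, -⟩
    rw [mem_ofPred_eq] at h2
    rw [← h2]
    exact DifferentiableAt.hasDerivAt h1
  have hlt : ∀ t ∈ A, (∀ b, t < b → F t < F b) ∧ ∀ b, b < t → F b < F t := fun t ht =>
    lt_of_hasDerivAt_pos_of_monotone hFm (hAd t ht) ht.2
  have hmem : ∀ t ∈ A, F t ∈ Ioo (0 : ℝ) 1 := fun t ht =>
    ⟨(cdf_nonneg _ (t - 1)).trans_lt ((hlt t ht).2 _ (by linarith)),
      ((hlt t ht).1 (t + 1) (by linarith)).trans_le (cdf_le_one _ _)⟩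
  have hΦQ : ∀ t ∈ A, Φ (Q (F t)) = F t := fun t ht => (hQ _ (hmem t ht)).1
  have hSne : ∀ t, {a | F a ≤ Φ t}.Nonempty := fun t =>
    ((tendsto_cdf_atBot ν).eventually_le_const (cdf_gaussianReal_mem_Ioo t).1).exists
  have hSbdd : ∀ t, BddAbove {a | F a ≤ Φ t} := by
    intro t
    obtain ⟨b, hb⟩ := ((tendsto_cdf_atTop ν).eventually_const_lt (cdf_gaussianReal_mem_Ioo t).2).exists
    exact ⟨b, fun a ha => le_of_not_gt fun h => (hb.trans_le (hFm h.le)).not_ge ha⟩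
  let S : ℝ → ℝ := fun t => sSup {a | F a ≤ Φ t}
  have hSmono : Monotone S := fun s t hst =>
    csSup_le_csSup (hSbdd t) (hSne s) fun a ha =>
      le_trans ha (strictMono_cdf_gaussianReal.monotone hst)
  have hleft : ∀ t ∈ A, S (Q (F t)) = t := by
    intro t ht
    have : {a | F a ≤ Φ (Q (F t))} = Iic t := by
      ext a
      rw [mem_ofPred_eq, hΦQ t ht, mem_Iic]
      exact ⟨fun h => le_of_not_gt fun h' => ((hlt t ht).1 a h').not_ge h, fun h => hFm h⟩
    simp only [S, this, csSup_Iic]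
  have hae : ∀ᵐ t, t ∉ A → f t = 0 := by
    have h1 := (cdf ν).ae_hasDerivAt
    rw [measure_cdf] at h1
    have h2 : ν.rnDeriv volume =ᵐ[volume] f := Measure.rnDeriv_withDensity volume hf
    have h3 : ∀ᵐ t, f t < ⊤ := ae_lt_top hf (by rw [hf1]; simp)
    filter_upwards [h1, h2, h3] with t h1 h2 h3 h4
    rw [h2] at h1
    by_contra h0
    exact h4 ⟨⟨h1.differentiableAt, h1.deriv⟩, ENNReal.toReal_pos h0 h3.ne⟩
  refine ⟨A, fun t => Q (F t), S, ?_, hae, fun t ht => ht.2, ?_, ?_, hSmono, hleft, ?_⟩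
  · exact ((measurableSet_of_differentiableAt ℝ F).inter
      (measurableSet_eq_fun (measurable_deriv F) hf.ennreal_toReal)).inter
      (measurableSet_lt measurable_const hf.ennreal_toReal)
  · intro a ha b hb hab
    rw [← strictMono_cdf_gaussianReal.lt_iff_lt]
    change Φ _ < Φ _
    rw [hΦQ a ha, hΦQ b hb]
    exact (hlt a ha).1 b hab
  · intro t ht
    have := (hQ _ (hmem t ht)).2.comp t (hAd t ht)
    rw [div_eq_inv_mul]
    exact this
  · intro k m hS
    -- Two points of `A` rule out a constant `S`, since `S` inverts the transport on `A`.
    have hA2 : A.Nontrivial := by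
      by_contra h
      rw [not_nontrivial_iff] at h
      have h0 : volume A = 0 := h.measure_zero _
      have : f =ᵐ[volume] 0 := by
        filter_upwards [hae, measure_eq_zero_iff_ae_notMem.1 h0] with t h1 h2 using h1 h2
      rw [lintegral_congr_ae this] at hf1
      simp at hf1
    have hk0 : 0 ≤ k := by
      have := hSmono (show (0 : ℝ) ≤ 1 by norm_num)
      rw [hS, hS] at this; linarith
    have hk : 0 < k := by
      refine lt_of_le_of_ne hk0 fun h => ?_
      obtain ⟨a, ha, b, hb, hab⟩ := hA2
      have h1 := hleft a ha; have h2 := hleft b hb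
      rw [hS, ← h] at h1 h2
      exact hab (by linarith)
    refine ⟨hk, ?_⟩
    have hgt : ∀ t a, S t < a → Φ t < F a := fun t a h =>
      lt_of_not_ge fun h' => (le_csSup (hSbdd t) h').not_gt h
    have hle : ∀ t a, a < S t → F a ≤ Φ t := by
      intro t a h
      obtain ⟨b, hb, hab⟩ := exists_lt_of_lt_csSup (hSne t) h
      exact (hFm hab.le).trans hb
    -- The supremum defining `S` only compares `F` and `Φ` off the graph of `S`. Letting `s` tend to
    -- `t` from either side and using the continuity of `Φ` gives equality, so `f` is the density of
    -- the affine image of the standard Gaussian.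
    have hFΦ : ∀ t, F (k * t + m) = Φ t := by
      intro t
      refine le_antisymm ?_ ?_
      · have hlim : Tendsto Φ (𝓝[>] t) (𝓝 (Φ t)) :=
          (continuous_cdf_gaussianReal.tendsto t).mono_left nhdsWithin_le_nhds
        refine ge_of_tendsto hlim ?_
        filter_upwards [self_mem_nhdsWithin] with s hs
        refine hle s _ ?_
        rw [hS]
        have := mul_lt_mul_of_pos_left (show t < s from hs) hk
        linarith
      · have hlim : Tendsto Φ (𝓝[<] t) (𝓝 (Φ t)) :=
          (continuous_cdf_gaussianReal.tendsto t).mono_left nhdsWithin_le_nhds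
        refine le_of_tendsto hlim ?_
        filter_upwards [self_mem_nhdsWithin] with s hs
        refine (hgt s _ ?_).le
        rw [hS]
        have := mul_lt_mul_of_pos_left (show s < t from hs) hk
        linarith
    have hmap : gaussianReal m (k ^ 2).toNNReal
        = ((gaussianReal 0 1).map (fun x => k * x)).map (fun x => x + m) := by
      rw [gaussianReal_map_const_mul, gaussianReal_map_add_const]
      congr 1
      · simp
      · ext; simp [sq_nonneg]
    refine Measure.eq_of_cdf _ _ (StieltjesFunction.ext fun x => ?_)
    have hx : x = k * ((x - m) / k) + m := by field_simp; ring
    change F x = _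
    rw [hx, hFΦ, hΦ, cdf_eq_real, cdf_eq_real, hmap, measureReal_def, measureReal_def,
      Measure.map_map (by fun_prop) (by fun_prop), Measure.map_apply (by fun_prop) measurableSet_Iic]
    congr 2
    ext y
    simp [hk]

/-! ### Pexider's equation almost everywhere, additive and multiplicative -/

/-- The two functions agree on a dense set, and at any point a monotone function lies between its
values at nearby points on either side. -/
theorem Monotone.eq_of_ae_eq_of_continuous {φ c : ℝ → ℝ} (hφ : Monotone φ) (hc : Continuous c)
    (h : φ =ᵐ[volume] c) : φ = c := by
  have hd : Dense {t | φ t = c t} := Measure.dense_of_ae h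
  ext x
  refine le_antisymm ?_ ?_
  · by_contra! hlt
    obtain ⟨ε, hε, hball⟩ :=
      Metric.eventually_nhds_iff.1 (hc.continuousAt.eventually_lt_const hlt)
    obtain ⟨t, ht, h'⟩ := hd.inter_open_nonempty (Set.Ioo x (x + ε)) isOpen_Ioo
      (Set.nonempty_Ioo.2 (by linarith))
    have h2 : c t < φ x := hball (by
      rw [Real.dist_eq, abs_lt]; constructor <;> linarith [ht.1, ht.2])
    have h3 : φ t = c t := h'
    linarith [hφ ht.1.le]
  · by_contra! hlt
    obtain ⟨ε, hε, hball⟩ :=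
      Metric.eventually_nhds_iff.1 (hc.continuousAt.eventually_const_lt hlt)
    obtain ⟨t, ht, h'⟩ := hd.inter_open_nonempty (Set.Ioo (x - ε) x) isOpen_Ioo
      (Set.nonempty_Ioo.2 (by linarith))
    have h2 : φ x < c t := hball (by
      rw [Real.dist_eq, abs_lt]; constructor <;> linarith [ht.1, ht.2])
    have h3 : φ t = c t := h'
    linarith [hφ ht.2.le]

theorem continuous_integral_Icc_shift {φ : ℝ → ℝ} (hφ : LocallyIntegrable φ) (a b : ℝ) :
    Continuous fun s => ∫ t in a..b, φ (s + t) := by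
  have hi : ∀ x y, IntervalIntegrable φ volume x y := fun x y =>
    (hφ.integrableOn_isCompact isCompact_uIcc).intervalIntegrable
  have : (fun s => ∫ t in a..b, φ (s + t))
      = fun s => (∫ t in (0 : ℝ)..(s + b), φ t) - ∫ t in (0 : ℝ)..(s + a), φ t := by
    ext s
    rw [intervalIntegral.integral_comp_add_left,
      intervalIntegral.integral_interval_sub_left (hi _ _) (hi _ _)]
  rw [this]
  have hp := intervalIntegral.continuous_primitive hi 0
  exact (hp.comp (by fun_prop : Continuous fun s : ℝ => s + b)).sub
    (hp.comp (by fun_prop : Continuous fun s : ℝ => s + a))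

/-- Averaging the equation over `t ∈ [0, 1]` expresses `ψ(s)` as a moving average of `φ` minus a
constant, and moving averages are continuous. -/
theorem exists_continuous_ae_eq_of_pexider {φ ψ χ : ℝ → ℝ} (hφ : LocallyIntegrable φ)
    (hχ : LocallyIntegrable χ) (h : ∀ᵐ z : ℝ × ℝ, φ (z.1 + z.2) = ψ z.1 + χ z.2) :
    ∃ c : ℝ → ℝ, Continuous c ∧ ψ =ᵐ[volume] c := by
  refine ⟨fun s => (∫ t in (0 : ℝ)..1, φ (s + t)) - ∫ t in (0 : ℝ)..1, χ t,
    (continuous_integral_Icc_shift hφ 0 1).sub continuous_const, ?_⟩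
  rw [Measure.volume_eq_prod] at h
  filter_upwards [Measure.ae_ae_of_ae_prod h] with s hs
  have : ∫ t in (0 : ℝ)..1, φ (s + t) = ∫ t in (0 : ℝ)..1, (ψ s + χ t) :=
    intervalIntegral.integral_congr_ae (hs.mono fun t ht _ => ht)
  rw [this, intervalIntegral.integral_add intervalIntegrable_const (hχ.integrableOn_isCompact isCompact_uIcc).intervalIntegrable]
  simp

/-- Monotone solutions of Pexider's equation almost everywhere are affine. -/
theorem affine_of_ae_pexider {φ ψ χ : ℝ → ℝ} (hφ : Monotone φ) (hψ : Monotone ψ) (hχ : Monotone χ)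
    (h : ∀ᵐ z : ℝ × ℝ, φ (z.1 + z.2) = ψ z.1 + χ z.2) :
    ∃ k α β : ℝ, (∀ r, φ r = k * r + (α + β)) ∧ (∀ s, ψ s = k * s + α) ∧
      ∀ t, χ t = k * t + β := by
  have hψc : Continuous ψ := by
    obtain ⟨c, hc, hc'⟩ := exists_continuous_ae_eq_of_pexider hφ.locallyIntegrable
      hχ.locallyIntegrable h
    rwa [hψ.eq_of_ae_eq_of_continuous hc hc']
  have hswap : ∀ᵐ z : ℝ × ℝ, φ (z.1 + z.2) = χ z.1 + ψ z.2 := by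
    have := (Measure.measurePreserving_swap (μ := (volume : Measure ℝ))
      (ν := (volume : Measure ℝ))).quasiMeasurePreserving.ae h
    filter_upwards [this] with z hz
    simpa [add_comm] using hz
  have hχc : Continuous χ := by
    obtain ⟨c, hc, hc'⟩ := exists_continuous_ae_eq_of_pexider hφ.locallyIntegrable
      hψ.locallyIntegrable hswap
    rwa [hχ.eq_of_ae_eq_of_continuous hc hc']
  have hφc : Continuous φ := by
    have h1 : Measure.QuasiMeasurePreserving
        (fun z : ℝ × ℝ => ((-1) * z.1 + 1 * z.2, 1 * z.1 + 0 * z.2)) volume volume :=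
      quasiMeasurePreserving_linearPair (by norm_num)
    -- In the coordinates `(t, s + t)` one good slice `t` already shows that `φ` is a translate of
    -- the continuous function `ψ` plus a constant.
    have h2 : ∀ᵐ z : ℝ × ℝ, φ z.2 = ψ (z.2 - z.1) + χ z.1 := by
      filter_upwards [h1.ae h] with z hz
      rw [show z.2 - z.1 = -1 * z.1 + 1 * z.2 by ring]
      simpa using hz
    rw [Measure.volume_eq_prod] at h2
    obtain ⟨t, ht⟩ := (Measure.ae_ae_of_ae_prod h2).exists
    have : φ = fun r => ψ (r - t) + χ t :=
      hφ.eq_of_ae_eq_of_continuous (by fun_prop) ht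
    rw [this]; fun_prop
  have hall : ∀ s t, φ (s + t) = ψ s + χ t := by
    have : (fun z : ℝ × ℝ => φ (z.1 + z.2)) = fun z => ψ z.1 + χ z.2 :=
      (Continuous.ae_eq_iff_eq volume (by fun_prop) (by fun_prop)).1 h
    intro s t
    exact congrFun this (s, t)
  -- Once the equation holds everywhere, `φ - φ 0` is additive and continuous, hence linear.
  let A : ℝ →+ ℝ :=
    { toFun := fun r => φ r - φ 0
      map_zero' := sub_self _
      map_add' := fun s t => by
        have h0 := hall 0 0; have h1 := hall s 0; have h2 := hall 0 t
        simp only [zero_add, add_zero] at h0 h1 h2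
        rw [hall s t, h1, h2, h0]; ring }
  have hAc : Continuous A := hφc.sub continuous_const
  have hlin : ∀ r, φ r = (φ 1 - φ 0) * r + φ 0 := by
    intro r
    have := (A.toRealLinearMap hAc).map_smul r 1
    simp only [smul_eq_mul, mul_one, AddMonoidHom.coe_toRealLinearMap] at this
    change φ r - φ 0 = r * (φ 1 - φ 0) at this
    linarith
  have h00 := hall 0 0
  simp only [add_zero] at h00
  refine ⟨φ 1 - φ 0, ψ 0, χ 0, fun r => ?_, fun s => ?_, fun t => ?_⟩
  · rw [hlin r, ← h00]
  · have := hall s 0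
    rw [add_zero, hlin s] at this; linarith
  · have := hall 0 t
    rw [zero_add, hlin t] at this; linarith

/-- Otherwise all primitives vanish, and by Lebesgue differentiation so does `H` almost everywhere.
-/
theorem exists_intervalIntegral_ne_zero {H : ℝ → ℝ} (hH : LocallyIntegrable H)
    (h0 : ∀ᵐ t, H t ≠ 0) : ∃ a b, ∫ t in a..b, H t ≠ 0 := by
  by_contra! hcon
  obtain ⟨t, ht, ht0⟩ := ((LocallyIntegrable.ae_hasDerivAt_integral hH).and h0).exists
  have h1 := ht 0
  rw [funext fun x => hcon 0 x] at h1
  exact ht0 (h1.unique (hasDerivAt_const t 0))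

/-- A unimodular function `G` such that `G(s) H(t)` depends only on `s + t` has constant sign. -/
theorem constant_sign_of_ae_mul_eq {G H E : ℝ → ℝ} (hH : LocallyIntegrable H)
    (hE : LocallyIntegrable E) (hG : ∀ᵐ s, |G s| = 1) (hH0 : ∀ᵐ t, H t ≠ 0)
    (h : ∀ᵐ z : ℝ × ℝ, G z.1 * H z.2 = E (z.1 + z.2)) :
    (∀ᵐ s, 0 ≤ G s) ∨ ∀ᵐ s, G s ≤ 0 := by
  obtain ⟨a, b, hab⟩ := exists_intervalIntegral_ne_zero hH hH0
  -- Integrating over `t` gives a continuous version `N` of `G`. It has modulus 1 everywhere, so by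
  -- the intermediate value theorem it cannot change sign.
  set N : ℝ → ℝ := fun s => (∫ t in a..b, E (s + t)) / ∫ t in a..b, H t
  have hN : Continuous N := (continuous_integral_Icc_shift hE a b).div_const _
  have hGN : G =ᵐ[volume] N := by
    rw [Measure.volume_eq_prod] at h
    filter_upwards [Measure.ae_ae_of_ae_prod h] with s hs
    have : ∫ t in a..b, E (s + t) = ∫ t in a..b, G s * H t :=
      intervalIntegral.integral_congr_ae (hs.mono fun t ht _ => ht.symm)
    simp only [N]
    rw [this, intervalIntegral.integral_const_mul]
    field_simp
  have hN1 : (fun s => |N s|) = fun _ => 1 :=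
    (Continuous.ae_eq_iff_eq volume (by fun_prop) (by fun_prop)).1 (by
      filter_upwards [hG, hGN] with s h1 h2; rw [← h2, h1])
  by_cases hneg : ∃ s, N s ≤ 0
  · right
    have : ∀ s, N s ≤ 0 := by
      by_contra! hpos
      obtain ⟨s, hs⟩ := mem_range_of_exists_le_of_exists_ge hN hneg (hpos.imp fun _ => le_of_lt)
      have := congrFun hN1 s
      simp [hs] at this
    filter_upwards [hGN] with s hs using hs ▸ this s
  · left
    push Not at hneg
    filter_upwards [hGN] with s hs using hs ▸ (hneg s).le

/-! ### The functional equation in frame coordinates -/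

namespace TightFrame

variable (F : TightFrame)

/-- The point `w` with `S₃ * u₂ w = z.1` and `-S₂ * u₃ w = z.2`, for which `D * w.1 = z.1 + z.2`. -/
noncomputable def point (z : ℝ × ℝ) : ℝ × ℝ :=
  (1 / F.D * z.1 + 1 / F.D * z.2, -F.C₃ / (F.S₃ * F.D) * z.1 + -F.C₂ / (F.S₂ * F.D) * z.2)

theorem u₂_point (z : ℝ × ℝ) : F.u₂ (F.point z) = z.1 / F.S₃ := by
  have h1 := F.D_pos.ne'; have h2 := F.S₂_pos.ne'; have h3 := F.S₃_pos.ne'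
  unfold point u₂
  field_simp
  unfold D; ring

theorem u₃_point (z : ℝ × ℝ) : F.u₃ (F.point z) = -z.2 / F.S₂ := by
  have h1 := F.D_pos.ne'; have h2 := F.S₂_pos.ne'; have h3 := F.S₃_pos.ne'
  unfold point u₃
  field_simp
  unfold D; ring

theorem point_fst (z : ℝ × ℝ) : (F.point z).1 = (z.1 + z.2) / F.D := by
  unfold point; ring

theorem qmp_point : Measure.QuasiMeasurePreserving F.point volume volume := by
  refine quasiMeasurePreserving_linearPair ?_
  have h1 := F.D_pos; have h2 := F.S₂_pos; have h3 := F.S₃_pos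
  have e : 1 / F.D * (-F.C₂ / (F.S₂ * F.D)) - 1 / F.D * (-F.C₃ / (F.S₃ * F.D))
      = - (F.D / (F.S₂ * F.S₃ * F.D ^ 2)) := by
    field_simp
    unfold D; ring
  rw [e]
  exact neg_ne_zero.2 (by positivity)

/-- In the coordinates of `point` the relation is Pexider's equation for `D R₁(r/D)`, `S₃ R₂(s/S₃)`
and `-S₂ R₃(-t/S₂)`. The two minus signs keep the last function increasing, and the scalings leave
one common slope `k`. -/
theorem affine_of_ae_eq {R₁ R₂ R₃ : ℝ → ℝ} (h₁ : Monotone R₁) (h₂ : Monotone R₂)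
    (h₃ : Monotone R₃)
    (h : ∀ᵐ w : ℝ × ℝ, F.D * R₁ w.1 = F.S₃ * R₂ (F.u₂ w) - F.S₂ * R₃ (F.u₃ w)) :
    ∃ k : ℝ, ∃ m : ℝ × ℝ, (∀ t, R₁ t = k * t + m.1) ∧ (∀ t, R₂ t = k * t + F.u₂ m) ∧
      ∀ t, R₃ t = k * t + F.u₃ m := by
  have hD := F.D_pos; have hS2 := F.S₂_pos; have hS3 := F.S₃_pos
  obtain ⟨k, α, β, hφ, hψ, hχ⟩ := affine_of_ae_pexider (φ := fun r => F.D * R₁ (r / F.D))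
    (ψ := fun s => F.S₃ * R₂ (s / F.S₃)) (χ := fun t => -(F.S₂ * R₃ (-t / F.S₂)))
    (fun a b hab => mul_le_mul_of_nonneg_left (h₁ (by gcongr)) hD.le)
    (fun a b hab => mul_le_mul_of_nonneg_left (h₂ (by gcongr)) hS3.le)
    (fun a b hab => neg_le_neg (mul_le_mul_of_nonneg_left (h₃ (by gcongr)) hS2.le))
    (by
      filter_upwards [F.qmp_point.ae h] with z hz
      rw [F.u₂_point, F.u₃_point, F.point_fst] at hz
      rw [hz]; ring)
  refine ⟨k, F.point (α, β), fun t => ?_, fun t => ?_, fun t => ?_⟩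
  · have := hφ (F.D * t)
    rw [mul_div_cancel_left₀ _ hD.ne'] at this
    rw [F.point_fst]; field_simp; linarith
  · have := hψ (F.S₃ * t)
    rw [mul_div_cancel_left₀ _ hS3.ne'] at this
    rw [F.u₂_point]; field_simp; linarith
  · have := hχ (-(F.S₂ * t))
    rw [neg_neg, mul_div_cancel_left₀ _ hS2.ne'] at this
    rw [F.u₃_point]; field_simp; linarith

end TightFrame

/-! ### The geometric Brascamp-Lieb inequality by transport -/

theorem StrictMonoOn.sub_mul_sub_nonneg {T : ℝ → ℝ} {A : Set ℝ} (hT : StrictMonoOn T A) {a b : ℝ}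
    (ha : a ∈ A) (hb : b ∈ A) : 0 ≤ (T a - T b) * (a - b) := by
  rcases le_total a b with h | h
  · exact mul_nonneg_of_nonpos_of_nonpos (by linarith [hT.monotoneOn ha hb h]) (by linarith)
  · exact mul_nonneg (by linarith [hT.monotoneOn hb ha h]) (by linarith)

theorem StrictMonoOn.eq_of_sub_mul_sub_eq_zero {T : ℝ → ℝ} {A : Set ℝ} (hT : StrictMonoOn T A)
    {a b : ℝ} (ha : a ∈ A) (hb : b ∈ A) (h : (T a - T b) * (a - b) = 0) : a = b := by
  rcases mul_eq_zero.1 h with h | h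
  · exact hT.injOn ha hb (by linarith)
  · linarith

namespace TightFrame

variable (F : TightFrame)

theorem prod_rpow_mul_exp {a : ℝ} (ha : 0 < a) (x₁ x₂ x₃ : ℝ) :
    (a * Real.exp x₁) ^ F.c₁ * (a * Real.exp x₂) ^ F.c₂ * (a * Real.exp x₃) ^ F.c₃
      = a ^ 2 * Real.exp (F.c₁ * x₁ + F.c₂ * x₂ + F.c₃ * x₃) := by
  have h : ∀ x c, (a * Real.exp x) ^ c = a ^ c * Real.exp (c * x) := by
    intro x c
    rw [Real.mul_rpow ha.le (Real.exp_pos x).le, ← Real.exp_mul, mul_comm x c]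
  have h2 : a ^ 2 = a ^ F.c₁ * a ^ F.c₂ * a ^ F.c₃ := by
    rw [← Real.rpow_add ha, ← Real.rpow_add ha, F.sum_c]; norm_num
  rw [h, h, h, h2, Real.exp_add, Real.exp_add]; ring

/-- The exponents combine by `sq_add_sq` at `z - m`, the normalizing constants by `∑ cᵢ = 2`. This
is why Gaussians of equal variance are extremal. -/
theorem prod_gaussianPDFReal_rpow (m : ℝ × ℝ) {v : NNReal} (hv : v ≠ 0) (z : ℝ × ℝ) :
    gaussianPDFReal m.1 v z.1 ^ F.c₁ * gaussianPDFReal (F.u₂ m) v (F.u₂ z) ^ F.c₂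
      * gaussianPDFReal (F.u₃ m) v (F.u₃ z) ^ F.c₃
      = gaussianPDFReal m.1 v z.1 * gaussianPDFReal m.2 v z.2 := by
  have hv' : (0 : ℝ) < v := NNReal.coe_pos.2 (pos_iff_ne_zero.2 hv)
  have key := F.sq_add_sq (z - m)
  have e2 : F.u₂ (z - m) = F.u₂ z - F.u₂ m := by simp only [u₂, Prod.fst_sub, Prod.snd_sub]; ring
  have e3 : F.u₃ (z - m) = F.u₃ z - F.u₃ m := by simp only [u₃, Prod.fst_sub, Prod.snd_sub]; ring
  rw [e2, e3, Prod.fst_sub, Prod.snd_sub] at key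
  simp only [gaussianPDFReal]
  rw [F.prod_rpow_mul_exp (by positivity), mul_mul_mul_comm, ← Real.exp_add, sq]
  congr 2
  field_simp
  linarith

/-- The combination `∑ cᵢ tᵢ uᵢ`. -/
def combine (t₁ t₂ t₃ : ℝ) : ℝ × ℝ :=
  (F.c₁ * t₁ + F.c₂ * F.C₂ * t₂ + F.c₃ * F.C₃ * t₃, F.c₂ * F.S₂ * t₂ + F.c₃ * F.S₃ * t₃)

/-- The quantity `∑ cᵢ (tᵢ - uᵢ · θ)²` with `θ = ∑ cᵢ tᵢ uᵢ`. -/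
def defect (t₁ t₂ t₃ : ℝ) : ℝ :=
  F.c₁ * (t₁ - (F.combine t₁ t₂ t₃).1) ^ 2 + F.c₂ * (t₂ - F.u₂ (F.combine t₁ t₂ t₃)) ^ 2
    + F.c₃ * (t₃ - F.u₃ (F.combine t₁ t₂ t₃)) ^ 2

theorem defect_nonneg (t₁ t₂ t₃ : ℝ) : 0 ≤ F.defect t₁ t₂ t₃ := by
  have := F.c₁_pos; have := F.c₂_pos; have := F.c₃_pos
  unfold defect; positivity

theorem eq_of_defect_eq_zero {t₁ t₂ t₃ : ℝ} (h : F.defect t₁ t₂ t₃ = 0) :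
    t₁ = (F.combine t₁ t₂ t₃).1 ∧ t₂ = F.u₂ (F.combine t₁ t₂ t₃)
      ∧ t₃ = F.u₃ (F.combine t₁ t₂ t₃) := by
  have h1 := F.c₁_pos; have h2 := F.c₂_pos; have h3 := F.c₃_pos
  have q1 := mul_nonneg h1.le (sq_nonneg (t₁ - (F.combine t₁ t₂ t₃).1))
  have q2 := mul_nonneg h2.le (sq_nonneg (t₂ - F.u₂ (F.combine t₁ t₂ t₃)))
  have q3 := mul_nonneg h3.le (sq_nonneg (t₃ - F.u₃ (F.combine t₁ t₂ t₃)))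
  unfold defect at h
  refine ⟨?_, ?_, ?_⟩
  · have : F.c₁ * (t₁ - (F.combine t₁ t₂ t₃).1) ^ 2 = 0 := by linarith
    simpa [h1.ne', sub_eq_zero] using this
  · have : F.c₂ * (t₂ - F.u₂ (F.combine t₁ t₂ t₃)) ^ 2 = 0 := by linarith
    simpa [h2.ne', sub_eq_zero] using this
  · have : F.c₃ * (t₃ - F.u₃ (F.combine t₁ t₂ t₃)) ^ 2 = 0 := by linarith
    simpa [h3.ne', sub_eq_zero] using this

/-- Pythagoras: with `θ = ∑ cᵢ tᵢ uᵢ` one has `∑ cᵢ tᵢ (uᵢ·θ) = |θ|² = ∑ cᵢ (uᵢ·θ)²`, so `∑ cᵢ tᵢ²`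
exceeds `|θ|²` by exactly the defect. -/
theorem prod_stdGaussian_rpow (t₁ t₂ t₃ : ℝ) :
    gaussianPDFReal 0 1 t₁ ^ F.c₁ * gaussianPDFReal 0 1 t₂ ^ F.c₂ * gaussianPDFReal 0 1 t₃ ^ F.c₃
      = gaussianPDFReal 0 1 (F.combine t₁ t₂ t₃).1 * gaussianPDFReal 0 1 (F.combine t₁ t₂ t₃).2
        * Real.exp (-F.defect t₁ t₂ t₃ / 2) := by
  have key : F.c₁ * t₁ ^ 2 + F.c₂ * t₂ ^ 2 + F.c₃ * t₃ ^ 2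
      = (F.combine t₁ t₂ t₃).1 ^ 2 + (F.combine t₁ t₂ t₃).2 ^ 2 + F.defect t₁ t₂ t₃ := by
    have h := F.sq_add_sq (F.combine t₁ t₂ t₃)
    have e : F.c₁ * t₁ * (F.combine t₁ t₂ t₃).1 + F.c₂ * t₂ * F.u₂ (F.combine t₁ t₂ t₃)
        + F.c₃ * t₃ * F.u₃ (F.combine t₁ t₂ t₃)
        = (F.combine t₁ t₂ t₃).1 ^ 2 + (F.combine t₁ t₂ t₃).2 ^ 2 := by
      simp only [combine, u₂, u₃]; ring
    unfold defect
    linear_combination 2 * e - h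
  simp only [gaussianPDFReal]
  rw [F.prod_rpow_mul_exp (by positivity), mul_mul_mul_comm, ← Real.exp_add, sq,
    mul_assoc (_ * _) (Real.exp _), ← Real.exp_add]
  congr 2
  simp only [NNReal.coe_one, sub_zero, mul_one]
  linarith

/-- The derivative of the transport map of the plane, in terms of the derivatives `rᵢ` of its
one-dimensional components. -/
noncomputable def transportDeriv (r₁ r₂ r₃ : ℝ) : ℝ × ℝ →L[ℝ] ℝ × ℝ :=
  LinearMap.toContinuousLinearMap (Matrix.toLin (.finTwoProd ℝ) (.finTwoProd ℝ)
    !![F.c₁ * r₁ + F.c₂ * F.C₂ ^ 2 * r₂ + F.c₃ * F.C₃ ^ 2 * r₃,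
      F.c₂ * F.C₂ * F.S₂ * r₂ + F.c₃ * F.C₃ * F.S₃ * r₃;
      F.c₂ * F.C₂ * F.S₂ * r₂ + F.c₃ * F.C₃ * F.S₃ * r₃,
      F.c₂ * F.S₂ ^ 2 * r₂ + F.c₃ * F.S₃ ^ 2 * r₃])

theorem det_transportDeriv (r₁ r₂ r₃ : ℝ) : (F.transportDeriv r₁ r₂ r₃).det =
    (F.c₁ * r₁ + F.c₂ * F.C₂ ^ 2 * r₂ + F.c₃ * F.C₃ ^ 2 * r₃)
      * (F.c₂ * F.S₂ ^ 2 * r₂ + F.c₃ * F.S₃ ^ 2 * r₃)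
    - (F.c₂ * F.C₂ * F.S₂ * r₂ + F.c₃ * F.C₃ * F.S₃ * r₃)
      * (F.c₂ * F.C₂ * F.S₂ * r₂ + F.c₃ * F.C₃ * F.S₃ * r₃) := by
  simp only [transportDeriv, LinearMap.det_toContinuousLinearMap, LinearMap.det_toLin,
    Matrix.det_fin_two_of]

theorem hasFDerivAt_combine {T₁ T₂ T₃ : ℝ → ℝ} {r₁ r₂ r₃ : ℝ} {z : ℝ × ℝ}
    (h₁ : HasDerivAt T₁ r₁ z.1) (h₂ : HasDerivAt T₂ r₂ (F.u₂ z)) (h₃ : HasDerivAt T₃ r₃ (F.u₃ z)) :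
    HasFDerivAt (fun z => F.combine (T₁ z.1) (T₂ (F.u₂ z)) (T₃ (F.u₃ z)))
      (F.transportDeriv r₁ r₂ r₃) z := by
  have hu (a b : ℝ) (z : ℝ × ℝ) : HasFDerivAt (fun z : ℝ × ℝ => a * z.1 + b * z.2)
      (a • ContinuousLinearMap.fst ℝ ℝ ℝ + b • ContinuousLinearMap.snd ℝ ℝ ℝ) z :=
    (hasFDerivAt_fst.const_mul a).add (hasFDerivAt_snd.const_mul b)
  have d₁ := h₁.comp_hasFDerivAt z (hasFDerivAt_fst (𝕜 := ℝ) (E := ℝ) (F := ℝ) (p := z))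
  have d₂ := h₂.comp_hasFDerivAt z (hu F.C₂ F.S₂ z)
  have d₃ := h₃.comp_hasFDerivAt z (hu F.C₃ F.S₃ z)
  have := (((d₁.const_mul F.c₁).add (d₂.const_mul (F.c₂ * F.C₂))).add
    (d₃.const_mul (F.c₃ * F.C₃))).prodMk
    ((d₂.const_mul (F.c₂ * F.S₂)).add (d₃.const_mul (F.c₃ * F.S₃)))
  refine this.congr_fderiv ?_
  unfold transportDeriv
  rw [Matrix.toLin_finTwoProd_toContinuousLinearMap]
  ext <;> simp <;> ring

end TightFrame

namespace TightFrame

variable (F : TightFrame)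

/-- The integrand `∏ fᵢ(uᵢ · z) ^ cᵢ` of the Brascamp-Lieb inequality. -/
noncomputable def product (f₁ f₂ f₃ : ℝ → ENNReal) (z : ℝ × ℝ) : ENNReal :=
  f₁ z.1 ^ F.c₁ * f₂ (F.u₂ z) ^ F.c₂ * f₃ (F.u₃ z) ^ F.c₃

theorem measurable_product {f₁ f₂ f₃ : ℝ → ENNReal} (h₁ : Measurable f₁) (h₂ : Measurable f₂)
    (h₃ : Measurable f₃) : Measurable (F.product f₁ f₂ f₃) := by
  unfold product; fun_prop

theorem ofReal_mul₃_rpow {a₁ a₂ a₃ : ENNReal} (h₁ : 0 < a₁.toReal) (h₂ : 0 < a₂.toReal)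
    (h₃ : 0 < a₃.toReal) : a₁ ^ F.c₁ * a₂ ^ F.c₂ * a₃ ^ F.c₃
      = ENNReal.ofReal (a₁.toReal ^ F.c₁ * a₂.toReal ^ F.c₂ * a₃.toReal ^ F.c₃) := by
  have e : ∀ a : ENNReal, 0 < a.toReal → ∀ c : ℝ, a ^ c = ENNReal.ofReal (a.toReal ^ c) := by
    intro a ha c
    rw [← ENNReal.ofReal_rpow_of_pos ha, ENNReal.ofReal_toReal (ENNReal.toReal_pos_iff.1 ha).2.ne]
  rw [e _ h₁, e _ h₂, e _ h₃, ENNReal.ofReal_mul (by positivity), ENNReal.ofReal_mul (by positivity)]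

theorem lintegral_gaussianPDF_prod : ∫⁻ w : ℝ × ℝ, ENNReal.ofReal
    (gaussianPDFReal 0 1 w.1 * gaussianPDFReal 0 1 w.2) = 1 := by
  have h : ∀ w : ℝ × ℝ, ENNReal.ofReal (gaussianPDFReal 0 1 w.1 * gaussianPDFReal 0 1 w.2)
      = gaussianPDF 0 1 w.1 * gaussianPDF 0 1 w.2 := fun w =>
    ENNReal.ofReal_mul (gaussianPDFReal_nonneg _ _ _)
  simp_rw [h]
  rw [Measure.volume_eq_prod, lintegral_prod_mul (measurable_gaussianPDF 0 1).aemeasurable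
    (measurable_gaussianPDF 0 1).aemeasurable, lintegral_gaussianPDF_eq_one _ one_ne_zero, one_mul]

/-- The geometric Brascamp-Lieb inequality in the plane, with its equality cases. -/
theorem lintegral_product_le_one {f₁ f₂ f₃ : ℝ → ENNReal} (hf₁ : Measurable f₁)
    (hf₂ : Measurable f₂) (hf₃ : Measurable f₃) (hi₁ : ∫⁻ t, f₁ t = 1) (hi₂ : ∫⁻ t, f₂ t = 1)
    (hi₃ : ∫⁻ t, f₃ t = 1) :
    ∫⁻ z, F.product f₁ f₂ f₃ z ≤ 1 ∧ (∫⁻ z, F.product f₁ f₂ f₃ z = 1 →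
      ∃ k : ℝ, ∃ m : ℝ × ℝ, 0 < k ∧
        (volume : Measure ℝ).withDensity f₁ = gaussianReal m.1 (k ^ 2).toNNReal ∧
        (volume : Measure ℝ).withDensity f₂ = gaussianReal (F.u₂ m) (k ^ 2).toNNReal ∧
        (volume : Measure ℝ).withDensity f₃ = gaussianReal (F.u₃ m) (k ^ 2).toNNReal) := by
  obtain ⟨A₁, T₁, R₁, h₁⟩ := exists_isGaussianTransport hf₁ hi₁
  obtain ⟨A₂, T₂, R₂, h₂⟩ := exists_isGaussianTransport hf₂ hi₂
  obtain ⟨A₃, T₃, R₃, h₃⟩ := exists_isGaussianTransport hf₃ hi₃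
  set φ : ℝ → ℝ := gaussianPDFReal 0 1 with hφ
  have hφpos : ∀ t, 0 < φ t := fun t => gaussianPDFReal_pos _ _ _ one_ne_zero
  have hφm : Measurable φ := measurable_gaussianPDFReal 0 1
  let s : Set (ℝ × ℝ) := (Prod.fst ⁻¹' A₁ ∩ F.u₂ ⁻¹' A₂) ∩ F.u₃ ⁻¹' A₃
  have hs : MeasurableSet s := ((measurable_fst h₁.measurableSet).inter
    (F.measurable_u₂ h₂.measurableSet)).inter (F.measurable_u₃ h₃.measurableSet)
  let r₁ : ℝ × ℝ → ℝ := fun z => (f₁ z.1).toReal / φ (T₁ z.1)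
  let r₂ : ℝ × ℝ → ℝ := fun z => (f₂ (F.u₂ z)).toReal / φ (T₂ (F.u₂ z))
  let r₃ : ℝ × ℝ → ℝ := fun z => (f₃ (F.u₃ z)).toReal / φ (T₃ (F.u₃ z))
  let Θ : ℝ × ℝ → ℝ × ℝ := fun z => F.combine (T₁ z.1) (T₂ (F.u₂ z)) (T₃ (F.u₃ z))
  let Θ' : ℝ × ℝ → ℝ × ℝ →L[ℝ] ℝ × ℝ := fun z => F.transportDeriv (r₁ z) (r₂ z) (r₃ z)
  let δ : ℝ × ℝ → ℝ := fun z => F.defect (T₁ z.1) (T₂ (F.u₂ z)) (T₃ (F.u₃ z))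
  let γ : ℝ × ℝ → ENNReal := fun w => ENNReal.ofReal (φ w.1 * φ w.2)
  have hγm : Measurable γ := by fun_prop
  have hΘ : ∀ z ∈ s, HasFDerivWithinAt Θ (Θ' z) s z := fun z hz =>
    (F.hasFDerivAt_combine (h₁.hasDerivAt _ hz.1.1) (h₂.hasDerivAt _ hz.1.2)
      (h₃.hasDerivAt _ hz.2)).hasFDerivWithinAt
  -- `⟨Θ z - Θ w, z - w⟩` is a sum of terms `cᵢ (Tᵢ a - Tᵢ b)(a - b) ≥ 0`. If `Θ z = Θ w` each of
  -- them vanishes, and strict monotonicity identifies the coordinates.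
  have hinj : Set.InjOn Θ s := by
    intro z hz w hw hzw
    have e : F.c₁ * ((T₁ z.1 - T₁ w.1) * (z.1 - w.1))
        + F.c₂ * ((T₂ (F.u₂ z) - T₂ (F.u₂ w)) * (F.u₂ z - F.u₂ w))
        + F.c₃ * ((T₃ (F.u₃ z) - T₃ (F.u₃ w)) * (F.u₃ z - F.u₃ w))
        = ((Θ z).1 - (Θ w).1) * (z.1 - w.1) + ((Θ z).2 - (Θ w).2) * (z.2 - w.2) := by
      simp only [Θ, combine]
      generalize T₁ z.1 = a, T₁ w.1 = a', T₂ (F.u₂ z) = b, T₂ (F.u₂ w) = b', T₃ (F.u₃ z) = c,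
        T₃ (F.u₃ w) = c'
      unfold u₂ u₃; ring
    rw [hzw, sub_self, sub_self, zero_mul, zero_mul, add_zero] at e
    have p₁ := h₁.strictMonoOn.sub_mul_sub_nonneg hz.1.1 hw.1.1
    have p₂ := h₂.strictMonoOn.sub_mul_sub_nonneg hz.1.2 hw.1.2
    have p₃ := h₃.strictMonoOn.sub_mul_sub_nonneg hz.2 hw.2
    have q₁ := mul_nonneg F.c₁_pos.le p₁
    have q₂ := mul_nonneg F.c₂_pos.le p₂
    have q₃ := mul_nonneg F.c₃_pos.le p₃
    have e₁ : z.1 = w.1 := h₁.strictMonoOn.eq_of_sub_mul_sub_eq_zero hz.1.1 hw.1.1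
      ((mul_eq_zero.1 (by linarith)).resolve_left F.c₁_pos.ne')
    have e₂ : F.u₂ z = F.u₂ w := h₂.strictMonoOn.eq_of_sub_mul_sub_eq_zero hz.1.2 hw.1.2
      ((mul_eq_zero.1 (by linarith)).resolve_left F.c₂_pos.ne')
    refine Prod.ext e₁ (mul_left_cancel₀ F.S₂_pos.ne' ?_)
    unfold u₂ at e₂
    rw [e₁] at e₂; linarith
  have hrestrict : ∫⁻ z, F.product f₁ f₂ f₃ z = ∫⁻ z in s, F.product f₁ f₂ f₃ z := by
    rw [← lintegral_indicator hs]
    refine lintegral_congr_ae ?_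
    have q₁ : ∀ᵐ z : ℝ × ℝ, z.1 ∉ A₁ → f₁ z.1 = 0 := by
      rw [Measure.volume_eq_prod]
      exact Measure.quasiMeasurePreserving_fst.ae h₁.ae_eq_zero
    filter_upwards [q₁, F.qmp_u₂.ae h₂.ae_eq_zero, F.qmp_u₃.ae h₃.ae_eq_zero] with z z₁ z₂ z₃
    by_cases hz : z ∈ s
    · rw [Set.indicator_of_mem hz]
    · rw [Set.indicator_of_notMem hz]
      unfold product
      by_cases a₁ : z.1 ∈ A₁
      · by_cases a₂ : F.u₂ z ∈ A₂
        · rw [z₃ fun a₃ => hz ⟨⟨a₁, a₂⟩, a₃⟩, ENNReal.zero_rpow_of_pos F.c₃_pos, mul_zero]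
        · rw [z₂ a₂, ENNReal.zero_rpow_of_pos F.c₂_pos, mul_zero, zero_mul]
      · rw [z₁ a₁, ENNReal.zero_rpow_of_pos F.c₁_pos, zero_mul, zero_mul]
  have hr : ∀ z ∈ s, 0 < r₁ z ∧ 0 < r₂ z ∧ 0 < r₃ z := fun z hz =>
    ⟨div_pos (h₁.pos _ hz.1.1) (hφpos _), div_pos (h₂.pos _ hz.1.2) (hφpos _),
      div_pos (h₃.pos _ hz.2) (hφpos _)⟩
  have hprod : ∀ z ∈ s, F.product f₁ f₂ f₃ z = ENNReal.ofReal
      ((r₁ z ^ F.c₁ * r₂ z ^ F.c₂ * r₃ z ^ F.c₃) * (φ (Θ z).1 * φ (Θ z).2)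
        * Real.exp (-δ z / 2)) := by
    intro z hz
    obtain ⟨p₁, p₂, p₃⟩ := hr z hz
    unfold product
    rw [F.ofReal_mul₃_rpow (h₁.pos _ hz.1.1) (h₂.pos _ hz.1.2) (h₃.pos _ hz.2)]
    have hg : φ (T₁ z.1) ^ F.c₁ * φ (T₂ (F.u₂ z)) ^ F.c₂ * φ (T₃ (F.u₃ z)) ^ F.c₃
        = φ (Θ z).1 * φ (Θ z).2 * Real.exp (-δ z / 2) := F.prod_stdGaussian_rpow _ _ _
    have d₁ : (f₁ z.1).toReal = r₁ z * φ (T₁ z.1) := (div_mul_cancel₀ _ (hφpos _).ne').symm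
    have d₂ : (f₂ (F.u₂ z)).toReal = r₂ z * φ (T₂ (F.u₂ z)) :=
      (div_mul_cancel₀ _ (hφpos _).ne').symm
    have d₃ : (f₃ (F.u₃ z)).toReal = r₃ z * φ (T₃ (F.u₃ z)) :=
      (div_mul_cancel₀ _ (hφpos _).ne').symm
    rw [mul_assoc _ (φ (Θ z).1 * φ (Θ z).2), ← hg, d₁, d₂, d₃, Real.mul_rpow p₁.le (hφpos _).le, Real.mul_rpow p₂.le (hφpos _).le,
      Real.mul_rpow p₃.le (hφpos _).le]
    congr 1; ring
  have hdet : ∀ z ∈ s, r₁ z ^ F.c₁ * r₂ z ^ F.c₂ * r₃ z ^ F.c₃ ≤ |(Θ' z).det| := by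
    intro z hz
    obtain ⟨p₁, p₂, p₃⟩ := hr z hz
    refine le_trans ?_ (le_abs_self _)
    rw [F.det_transportDeriv]
    exact F.prod_rpow_le_det p₁ p₂ p₃
  have hexp : ∀ z, Real.exp (-δ z / 2) ≤ 1 := fun z => by
    rw [Real.exp_le_one_iff]
    have := F.defect_nonneg (T₁ z.1) (T₂ (F.u₂ z)) (T₃ (F.u₃ z))
    simp only [δ]; linarith
  have hγpos : ∀ w : ℝ × ℝ, 0 < φ w.1 * φ w.2 := fun w => mul_pos (hφpos _) (hφpos _)
  -- The integrand is at most the pulled-back Gaussian density; the losses are the determinant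
  -- inequality and the factor `exp(-δ/2)`.
  have hle : ∀ z ∈ s, F.product f₁ f₂ f₃ z ≤ ENNReal.ofReal |(Θ' z).det| * γ (Θ z) := by
    intro z hz
    rw [hprod z hz, ← ENNReal.ofReal_mul (abs_nonneg _)]
    refine ENNReal.ofReal_le_ofReal ?_
    calc _ ≤ |(Θ' z).det| * (φ (Θ z).1 * φ (Θ z).2) * 1 := by
          gcongr
          · exact mul_nonneg (abs_nonneg _) (hγpos _).le
          · exact (hγpos _).le
          · exact hdet z hz
          · exact hexp z
      _ = _ := mul_one _
  have hcov : ∫⁻ w in Θ '' s, γ w = ∫⁻ z in s, ENNReal.ofReal |(Θ' z).det| * γ (Θ z) :=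
    lintegral_image_eq_lintegral_abs_det_fderiv_mul volume hs hΘ hinj γ
  have hγ1 : ∫⁻ w, γ w = 1 := lintegral_gaussianPDF_prod
  have hle1 : ∫⁻ z in s, F.product f₁ f₂ f₃ z ≤ ∫⁻ w in Θ '' s, γ w := by
    rw [hcov]
    exact setLIntegral_mono' hs hle
  have hle2 : ∫⁻ w in Θ '' s, γ w ≤ 1 := hγ1 ▸ setLIntegral_le_lintegral _ _
  rw [hrestrict]
  refine ⟨hle1.trans hle2, fun heq => ?_⟩
  have hΘs : MeasurableSet (Θ '' s) := measurable_image_of_fderivWithin hs hΘ hinj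
  -- almost every point of the plane lies in the range of the transport
  have hfull : ∀ᵐ w : ℝ × ℝ, w ∈ Θ '' s := by
    have h1 : ∫⁻ w in Θ '' s, γ w = 1 := le_antisymm hle2 (heq ▸ hle1)
    have h2 := lintegral_add_compl γ hΘs (μ := volume)
    rw [h1, hγ1] at h2
    have h3 : ∫⁻ w in (Θ '' s)ᶜ, γ w = 0 := by
      have : (1 : ENNReal) + ∫⁻ w in (Θ '' s)ᶜ, γ w = 1 + 0 := by rw [h2, add_zero]
      exact (ENNReal.add_right_inj ENNReal.one_ne_top).1 this
    rw [lintegral_eq_zero_iff hγm] at h3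
    have h4 := (ae_restrict_iff' hΘs.compl).1 h3
    filter_upwards [h4] with w hw
    by_contra hn
    have := hw hn
    simp only [γ, Pi.zero_apply, ENNReal.ofReal_eq_zero] at this
    exact (hγpos w).not_ge this
  -- Equal finite integrals turn the pointwise bound into an almost everywhere equality. Only the
  -- factor `exp(-δ/2) = 1` is exploited; equality in the determinant inequality is not.
  have hdefect : ∀ᵐ z, z ∈ s → δ z = 0 := by
    have hm₁ : AEMeasurable (fun z : ℝ × ℝ => T₁ z.1) (volume.restrict s) := by
      refine ContinuousOn.aemeasurable (fun z hz => ?_) hs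
      exact ((h₁.hasDerivAt _ hz.1.1).continuousAt.comp
        continuous_fst.continuousAt).continuousWithinAt
    have hm₂ : AEMeasurable (fun z : ℝ × ℝ => T₂ (F.u₂ z)) (volume.restrict s) := by
      refine ContinuousOn.aemeasurable (fun z hz => ?_) hs
      exact ((h₂.hasDerivAt _ hz.1.2).continuousAt.comp (f := F.u₂) (Continuous.continuousAt (by
        unfold u₂; fun_prop))).continuousWithinAt
    have hm₃ : AEMeasurable (fun z : ℝ × ℝ => T₃ (F.u₃ z)) (volume.restrict s) := by
      refine ContinuousOn.aemeasurable (fun z hz => ?_) hs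
      exact ((h₃.hasDerivAt _ hz.2).continuousAt.comp (f := F.u₃) (Continuous.continuousAt (by
        unfold u₃; fun_prop))).continuousWithinAt
    have hr₁ : AEMeasurable r₁ (volume.restrict s) := by
      have := hφm.comp_aemeasurable hm₁
      exact AEMeasurable.div (by fun_prop) this
    have hr₂ : AEMeasurable r₂ (volume.restrict s) := by
      have := hφm.comp_aemeasurable hm₂
      exact AEMeasurable.div (by fun_prop) this
    have hr₃ : AEMeasurable r₃ (volume.restrict s) := by
      have := hφm.comp_aemeasurable hm₃
      exact AEMeasurable.div (by fun_prop) this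
    have hΘm : AEMeasurable Θ (volume.restrict s) := by
      exact (((hm₁.const_mul _).add (hm₂.const_mul _)).add (hm₃.const_mul _)).prodMk
        ((hm₂.const_mul _).add (hm₃.const_mul _))
    have hG : AEMeasurable (fun z => ENNReal.ofReal |(Θ' z).det| * γ (Θ z))
        (volume.restrict s) := by
      refine AEMeasurable.mul ?_ (hγm.comp_aemeasurable hΘm)
      refine ENNReal.measurable_ofReal.comp_aemeasurable (measurable_norm.comp_aemeasurable
        (f := fun z => (Θ' z).det) ?_)
      simp only [Θ', det_transportDeriv]
      fun_prop
    have hae := ae_eq_of_ae_le_of_lintegral_le (ae_restrict_of_forall_mem hs hle)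
      (by rw [heq]; exact ENNReal.one_ne_top) hG (by rw [← hcov, heq]; exact hle2)
    filter_upwards [(ae_restrict_iff' hs).1 hae] with z hz hzs
    have e := hz hzs
    rw [hprod z hzs, ← ENNReal.ofReal_mul (abs_nonneg _)] at e
    obtain ⟨p₁, p₂, p₃⟩ := hr z hzs
    have hX : 0 < (r₁ z ^ F.c₁ * r₂ z ^ F.c₂ * r₃ z ^ F.c₃) * (φ (Θ z).1 * φ (Θ z).2) :=
      mul_pos (by positivity) (hγpos _)
    have hXY : (r₁ z ^ F.c₁ * r₂ z ^ F.c₂ * r₃ z ^ F.c₃) * (φ (Θ z).1 * φ (Θ z).2)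
        ≤ |(Θ' z).det| * (φ (Θ z).1 * φ (Θ z).2) :=
      mul_le_mul_of_nonneg_right (hdet z hzs) (hγpos _).le
    rw [ENNReal.ofReal_eq_ofReal_iff (by positivity) (hX.le.trans hXY)] at e
    have h1 : Real.exp (-δ z / 2) = 1 := by
      refine le_antisymm (hexp z) (le_of_mul_le_mul_left ?_ hX)
      rw [mul_one, e]; exact hXY
    rw [Real.exp_eq_one_iff] at h1
    linarith
  -- `Θ` is differentiable, so it maps the null set `δ ≠ 0` to a null set. Almost every `w` is thus
  -- `Θ z` with `Tᵢ(uᵢ·z) = uᵢ·w`, that is `Rᵢ(uᵢ·w) = uᵢ·z`, and the linear relation between the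
  -- `uᵢ` applies.
  have hR : ∀ᵐ w : ℝ × ℝ, F.D * R₁ w.1 = F.S₃ * R₂ (F.u₂ w) - F.S₂ * R₃ (F.u₃ w) := by
    have hN : volume {z | z ∈ s ∧ δ z ≠ 0} = 0 := by
      rw [ae_iff] at hdefect
      simpa using hdefect
    have hN' : volume (Θ '' {z | z ∈ s ∧ δ z ≠ 0}) = 0 :=
      addHaar_image_eq_zero_of_differentiableOn_of_addHaar_eq_zero volume
        (fun z hz => ((hΘ z hz.1).mono fun _ h => h.1).differentiableWithinAt) hN
    filter_upwards [hfull, measure_eq_zero_iff_ae_notMem.1 hN'] with w ⟨z, hz, hzw⟩ hw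
    have hδ : δ z = 0 := by
      by_contra hne
      exact hw ⟨z, ⟨hz, hne⟩, hzw⟩
    obtain ⟨e₁, e₂, e₃⟩ := F.eq_of_defect_eq_zero hδ
    change T₁ z.1 = (Θ z).1 at e₁
    change T₂ (F.u₂ z) = F.u₂ (Θ z) at e₂
    change T₃ (F.u₃ z) = F.u₃ (Θ z) at e₃
    rw [← hzw, ← e₁, ← e₂, ← e₃, h₁.leftInv _ hz.1.1, h₂.leftInv _ hz.1.2, h₃.leftInv _ hz.2]
    exact F.D_mul_fst z
  obtain ⟨k, m, hk₁, hk₂, hk₃⟩ := F.affine_of_ae_eq h₁.monotone h₂.monotone h₃.monotone hR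
  obtain ⟨hk, g₁⟩ := h₁.eq_gaussian_of_affine _ _ hk₁
  exact ⟨k, m, hk, g₁, (h₂.eq_gaussian_of_affine _ _ hk₂).2, (h₃.eq_gaussian_of_affine _ _ hk₃).2⟩

end TightFrame

/-! ### Duality of Lebesgue spaces -/

open Filter Topology in
/-- If `∫ f ^ c * τ ≤ (∫ f) ^ c * M` for all integrable `f`, then the norm of `τ` in the dual
Lebesgue space is at most `M`. -/
theorem lintegral_rpow_le_of_forall_lintegral_mul_le {α : Type*} [MeasurableSpace α] {μ : Measure α}
    [SigmaFinite μ] {τ : α → ENNReal} (hτ : Measurable τ) {c : ℝ} (hc0 : 0 < c) (hc1 : c < 1)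
    {M : ENNReal} (h : ∀ f : α → ENNReal, Measurable f → ∫⁻ x, f x ∂μ ≠ ⊤ →
      ∫⁻ x, f x ^ c * τ x ∂μ ≤ (∫⁻ x, f x ∂μ) ^ c * M) :
    ∫⁻ x, τ x ^ (1 / (1 - c)) ∂μ ≤ M ^ (1 / (1 - c)) := by
  set q := 1 / (1 - c) with hq
  have hc1' : 0 < 1 - c := by linarith
  have hq0 : 0 < q := by positivity
  have hqc : q * c + 1 = q := by rw [hq]; field_simp; ring
  -- The extremal test function is `τ ^ q`, but its integral may be infinite. Truncating in height
  -- and in support makes it finite, so that `I ≤ I ^ c * M` can be divided by `I ^ c`; monotone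
  -- convergence removes the truncation.
  let t : ℕ → α → ENNReal := fun n => (spanningSets μ n).indicator fun x => min (τ x) n
  have htm : ∀ n, Measurable (t n) := fun n =>
    (hτ.min measurable_const).indicator (measurableSet_spanningSets μ n)
  have htle : ∀ n x, t n x ≤ τ x := fun n x =>
    (Set.indicator_le_self' (fun _ _ => zero_le) x).trans (min_le_left _ _)
  have htn : ∀ n, ∫⁻ x, t n x ^ q ∂μ ≤ M ^ q := by
    intro n
    have hfin : ∫⁻ x, t n x ^ q ∂μ ≠ ⊤ := by
      have h1 : ∫⁻ x, t n x ^ q ∂μ ≤ ∫⁻ x, (spanningSets μ n).indicator (fun _ => (n : ENNReal) ^ q) x ∂μ := by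
        refine lintegral_mono fun x => ?_
        by_cases hx : x ∈ spanningSets μ n
        · simp only [t, Set.indicator_of_mem hx]
          exact ENNReal.rpow_le_rpow (min_le_right _ _) hq0.le
        · simp only [t, Set.indicator_of_notMem hx]
          rw [ENNReal.zero_rpow_of_pos hq0]
      refine (h1.trans_lt ?_).ne
      rw [lintegral_indicator (measurableSet_spanningSets μ n), setLIntegral_const]
      exact ENNReal.mul_lt_top (ENNReal.rpow_lt_top_of_nonneg hq0.le (ENNReal.natCast_ne_top n))
        (measure_spanningSets_lt_top μ n)
    set I := ∫⁻ x, t n x ^ q ∂μ with hI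
    have h2 : I ≤ I ^ c * M := by
      refine le_trans ?_ (h (fun x => t n x ^ q) ((htm n).pow_const q) hfin)
      refine lintegral_mono fun x => ?_
      calc t n x ^ q = (t n x ^ q) ^ c * t n x := by
            rw [← ENNReal.rpow_mul]
            nth_rw 1 [← hqc]
            rw [ENNReal.rpow_add_of_nonneg _ _ (by positivity) zero_le_one, ENNReal.rpow_one]
        _ ≤ _ := mul_le_mul_right (htle n x) _
    rcases eq_or_ne I 0 with h0 | h0
    · rw [h0]; exact zero_le
    have h3 : I ^ (1 - c) ≤ M := by
      have h4 : I ^ c * I ^ (1 - c) ≤ I ^ c * M := by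
        rwa [← ENNReal.rpow_add _ _ h0 hfin, add_sub_cancel, ENNReal.rpow_one]
      have h5 : I ^ c ≠ 0 := (ENNReal.rpow_pos (pos_iff_ne_zero.2 h0) hfin).ne'
      exact (ENNReal.mul_le_mul_iff_right h5 (ENNReal.rpow_ne_top_of_nonneg hc0.le hfin)).1 h4
    calc I = (I ^ (1 - c)) ^ q := by
          rw [← ENNReal.rpow_mul, hq, mul_one_div_cancel hc1'.ne', ENNReal.rpow_one]
      _ ≤ _ := ENNReal.rpow_le_rpow h3 hq0.le
  refine le_of_tendsto' (x := atTop) (f := fun n => ∫⁻ x, t n x ^ q ∂μ) ?_ htn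
  refine lintegral_tendsto_of_tendsto_of_monotone (fun n => ((htm n).pow_const q).aemeasurable)
    (ae_of_all _ fun x m n hmn => ?_) (ae_of_all _ fun x => ?_)
  · refine ENNReal.rpow_le_rpow ?_ hq0.le
    have h1 : min (τ x) (m : ENNReal) ≤ min (τ x) n := min_le_min_left _ (Nat.cast_le.2 hmn)
    refine (Set.indicator_le_indicator (g := fun x => min (τ x) (n : ENNReal)) h1).trans ?_
    exact Set.indicator_le_indicator_of_subset (monotone_spanningSets μ hmn) (fun _ => zero_le) x
  · refine (ENNReal.continuous_rpow_const.tendsto _).comp ?_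
    have h1 : Tendsto (fun n : ℕ => min (τ x) (n : ENNReal)) atTop (𝓝 (min (τ x) ⊤)) :=
      tendsto_const_nhds.min ENNReal.tendsto_nat_nhds_top
    rw [min_top_right] at h1
    refine h1.congr' ?_
    filter_upwards [eventually_ge_atTop (spanningSetsIndex μ x)] with n hn
    have : x ∈ spanningSets μ n := monotone_spanningSets μ hn (mem_spanningSetsIndex μ x)
    simp only [t, Set.indicator_of_mem this]

/-! ### From Lebesgue measure to multiplicative weights -/

namespace TightFrame

variable (F : TightFrame)

/-- `w` is a positive density of `μ` that is multiplicative along the frame, so that the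
Brascamp-Lieb inequality for the Lebesgue measure is also one for `μ`. -/
structure IsWeight (μ : Measure ℝ) (w : ℝ → ENNReal) : Prop where
  measurable : Measurable w
  ne_zero : ∀ t, w t ≠ 0
  ne_top : ∀ t, w t ≠ ⊤
  eq_withDensity : μ = (volume : Measure ℝ).withDensity w
  product_eq : ∀ z, F.product w w w z = w z.1 * w z.2

theorem isWeight_volume : F.IsWeight volume 1 where
  measurable := measurable_one
  ne_zero _ := one_ne_zero
  ne_top _ := ENNReal.one_ne_top
  eq_withDensity := withDensity_one.symm
  product_eq z := by simp [product]

theorem product_gaussianPDF (m : ℝ × ℝ) {v : NNReal} (hv : v ≠ 0) (z : ℝ × ℝ) :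
    F.product (gaussianPDF m.1 v) (gaussianPDF (F.u₂ m) v) (gaussianPDF (F.u₃ m) v) z
      = gaussianPDF m.1 v z.1 * gaussianPDF m.2 v z.2 := by
  unfold product
  rw [F.ofReal_mul₃_rpow, toReal_gaussianPDF, toReal_gaussianPDF, toReal_gaussianPDF,
    F.prod_gaussianPDFReal_rpow m hv, ENNReal.ofReal_mul (gaussianPDFReal_nonneg _ _ _)]
  · rfl
  all_goals
    rw [toReal_gaussianPDF]; exact gaussianPDFReal_pos _ _ _ hv

theorem isWeight_gaussianReal : F.IsWeight (gaussianReal 0 1) (gaussianPDF 0 1) where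
  measurable := measurable_gaussianPDF 0 1
  ne_zero t := (gaussianPDF_pos 0 one_ne_zero t).ne'
  ne_top t := gaussianPDF_ne_top
  eq_withDensity := gaussianReal_of_var_ne_zero 0 one_ne_zero
  product_eq z := by
    have := F.product_gaussianPDF 0 one_ne_zero z
    simpa [u₂, u₃] using this

theorem product_mul (f₁ f₂ f₃ g₁ g₂ g₃ : ℝ → ENNReal) (z : ℝ × ℝ) :
    F.product (f₁ * g₁) (f₂ * g₂) (f₃ * g₃) z = F.product f₁ f₂ f₃ z * F.product g₁ g₂ g₃ z := by
  unfold product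
  simp only [Pi.mul_apply]
  rw [ENNReal.mul_rpow_of_nonneg _ _ F.c₁_pos.le, ENNReal.mul_rpow_of_nonneg _ _ F.c₂_pos.le,
    ENNReal.mul_rpow_of_nonneg _ _ F.c₃_pos.le]
  ring

variable {F}

namespace IsWeight

variable {μ : Measure ℝ} {w : ℝ → ENNReal}

theorem sigmaFinite (W : F.IsWeight μ w) : SigmaFinite μ := by
  rw [W.eq_withDensity]
  exact SigmaFinite.withDensity_of_ne_top (ae_of_all _ W.ne_top)

theorem absolutelyContinuous (W : F.IsWeight μ w) : μ ≪ volume := by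
  rw [W.eq_withDensity]; exact withDensity_absolutelyContinuous _ _

theorem absolutelyContinuous' (W : F.IsWeight μ w) : volume ≪ μ := by
  rw [W.eq_withDensity]
  exact withDensity_absolutelyContinuous' W.measurable.aemeasurable (ae_of_all _ W.ne_zero)

theorem prod_eq (W : F.IsWeight μ w) :
    μ.prod μ = (volume : Measure (ℝ × ℝ)).withDensity fun z => w z.1 * w z.2 := by
  have := W.sigmaFinite
  have h : SFinite ((volume : Measure ℝ).withDensity w) := by rw [← W.eq_withDensity]; infer_instance
  rw [W.eq_withDensity, prod_withDensity W.measurable W.measurable, Measure.volume_eq_prod]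

theorem withDensity_eq (W : F.IsWeight μ w) {f : ℝ → ENNReal} (hf : Measurable f) :
    μ.withDensity f = (volume : Measure ℝ).withDensity (w * f) := by
  rw [W.eq_withDensity, withDensity_mul _ W.measurable hf]

theorem lintegral_eq (W : F.IsWeight μ w) {f : ℝ → ENNReal} (hf : Measurable f) :
    ∫⁻ t, f t ∂μ = ∫⁻ t, (w * f) t := by
  rw [W.eq_withDensity, lintegral_withDensity_eq_lintegral_mul _ W.measurable hf]

theorem withDensity_prod_eq (W : F.IsWeight μ w) {f₁ f₂ f₃ : ℝ → ENNReal} (hf₁ : Measurable f₁)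
    (hf₂ : Measurable f₂) (hf₃ : Measurable f₃) :
    (μ.prod μ).withDensity (F.product f₁ f₂ f₃)
      = (volume : Measure (ℝ × ℝ)).withDensity (F.product (w * f₁) (w * f₂) (w * f₃)) := by
  have hw := W.measurable
  rw [W.prod_eq, ← withDensity_mul _ (by fun_prop) (F.measurable_product hf₁ hf₂ hf₃)]
  congr 1
  ext z
  rw [F.product_mul, W.product_eq, Pi.mul_apply]

/-- The Lebesgue case applied to the densities `w fᵢ`, whose product is the original integrand times
the density of `μ ⊗ μ`. -/
theorem lintegral_product_le_one (W : F.IsWeight μ w) {f₁ f₂ f₃ : ℝ → ENNReal}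
    (hf₁ : Measurable f₁) (hf₂ : Measurable f₂) (hf₃ : Measurable f₃) (hi₁ : ∫⁻ t, f₁ t ∂μ = 1)
    (hi₂ : ∫⁻ t, f₂ t ∂μ = 1) (hi₃ : ∫⁻ t, f₃ t ∂μ = 1) :
    ∫⁻ z, F.product f₁ f₂ f₃ z ∂(μ.prod μ) ≤ 1 ∧ (∫⁻ z, F.product f₁ f₂ f₃ z ∂(μ.prod μ) = 1 →
      ∃ v : NNReal, ∃ m : ℝ × ℝ, v ≠ 0 ∧ μ.withDensity f₁ = gaussianReal m.1 v ∧
        μ.withDensity f₂ = gaussianReal (F.u₂ m) v ∧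
        μ.withDensity f₃ = gaussianReal (F.u₃ m) v) := by
  have h := F.lintegral_product_le_one (W.measurable.mul hf₁) (W.measurable.mul hf₂)
    (W.measurable.mul hf₃) (by rw [← W.lintegral_eq hf₁, hi₁]) (by rw [← W.lintegral_eq hf₂, hi₂])
    (by rw [← W.lintegral_eq hf₃, hi₃])
  have e : ∫⁻ z, F.product f₁ f₂ f₃ z ∂(μ.prod μ)
      = ∫⁻ z, F.product (w * f₁) (w * f₂) (w * f₃) z := by
    rw [← setLIntegral_univ, ← withDensity_apply _ .univ, W.withDensity_prod_eq hf₁ hf₂ hf₃,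
      withDensity_apply _ .univ, setLIntegral_univ]
  rw [e]
  refine ⟨h.1, fun h1 => ?_⟩
  obtain ⟨k, m, hk, h₁, h₂, h₃⟩ := h.2 h1
  refine ⟨(k ^ 2).toNNReal, m, ?_, ?_, ?_, ?_⟩
  · rw [Ne, Real.toNNReal_eq_zero, not_le]; positivity
  · rw [W.withDensity_eq hf₁, h₁]
  · rw [W.withDensity_eq hf₂, h₂]
  · rw [W.withDensity_eq hf₃, h₃]

theorem mul_ae_eq_gaussianPDF (W : F.IsWeight μ w) {f : ℝ → ENNReal} (hf : Measurable f) {a : ℝ}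
    {v : NNReal} (hv : v ≠ 0) (h : μ.withDensity f = gaussianReal a v) :
    w * f =ᵐ[volume] gaussianPDF a v := by
  rw [W.withDensity_eq hf, gaussianReal_of_var_ne_zero _ hv] at h
  exact (withDensity_eq_iff_of_sigmaFinite (W.measurable.mul hf).aemeasurable
    (measurable_gaussianPDF a v).aemeasurable).1 h

/-- The converse in the equality case: the integrand is then itself a product of Gaussian
probability densities, so it has mass 1. -/
theorem withDensity_product_of_gaussian (W : F.IsWeight μ w) {f₁ f₂ f₃ : ℝ → ENNReal}
    (hf₁ : Measurable f₁) (hf₂ : Measurable f₂) (hf₃ : Measurable f₃) {m : ℝ × ℝ} {v : NNReal}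
    (hv : v ≠ 0) (h₁ : μ.withDensity f₁ = gaussianReal m.1 v)
    (h₂ : μ.withDensity f₂ = gaussianReal (F.u₂ m) v)
    (h₃ : μ.withDensity f₃ = gaussianReal (F.u₃ m) v) :
    (μ.prod μ).withDensity (F.product f₁ f₂ f₃)
      = (gaussianReal m.1 v).prod (gaussianReal m.2 v) := by
  rw [W.withDensity_prod_eq hf₁ hf₂ hf₃, gaussianReal_of_var_ne_zero _ hv,
    gaussianReal_of_var_ne_zero _ hv, prod_withDensity (measurable_gaussianPDF _ _)
    (measurable_gaussianPDF _ _), ← Measure.volume_eq_prod]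
  refine withDensity_congr_ae ?_
  have q₁ : ∀ᵐ z : ℝ × ℝ, (w * f₁) z.1 = gaussianPDF m.1 v z.1 := by
    rw [Measure.volume_eq_prod]
    exact Measure.quasiMeasurePreserving_fst.ae (W.mul_ae_eq_gaussianPDF hf₁ hv h₁)
  filter_upwards [q₁, F.qmp_u₂.ae (W.mul_ae_eq_gaussianPDF hf₂ hv h₂),
    F.qmp_u₃.ae (W.mul_ae_eq_gaussianPDF hf₃ hv h₃)] with z z₁ z₂ z₃
  rw [← F.product_gaussianPDF m hv]
  unfold product
  rw [z₁, z₂, z₃]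

end IsWeight

end TightFrame

/-! ### The convolution inequality for nonnegative functions -/

namespace TightFrame

variable (F : TightFrame)

/-- The convolution of nonnegative functions along the frame. -/
noncomputable def lconv (μ : Measure ℝ) (A B : ℝ → ENNReal) (x : ℝ) : ENNReal :=
  ∫⁻ y, A (F.u₂ (x, y)) * B (F.u₃ (x, y)) ∂μ

theorem measurable_lconv {μ : Measure ℝ} [SFinite μ] {A B : ℝ → ENNReal} (hA : Measurable A)
    (hB : Measurable B) : Measurable (F.lconv μ A B) := by
  refine Measurable.lintegral_prod_right' (f := fun z => A (F.u₂ z) * B (F.u₃ z)) ?_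
  fun_prop

/-- Tonelli: pairing the convolution with `f ^ c₁` gives a Brascamp-Lieb integral, which is the
duality between the two inequalities. -/
theorem lintegral_rpow_mul_lconv {μ : Measure ℝ} [SFinite μ] {f A B : ℝ → ENNReal}
    (hf : Measurable f) (hA : Measurable A) (hB : Measurable B) :
    ∫⁻ x, f x ^ F.c₁ * F.lconv μ A B x ∂μ = ∫⁻ z, F.product f (fun t => A t ^ (1 / F.c₂))
      (fun t => B t ^ (1 / F.c₃)) z ∂(μ.prod μ) := by
  rw [lintegral_prod _ (F.measurable_product hf (hA.pow_const _) (hB.pow_const _)).aemeasurable]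
  refine lintegral_congr fun x => ?_
  rw [lconv, ← lintegral_const_mul _ (by fun_prop)]
  refine lintegral_congr fun y => ?_
  simp only [product]
  rw [← ENNReal.rpow_mul, ← ENNReal.rpow_mul, one_div_mul_cancel F.c₂_pos.ne',
    one_div_mul_cancel F.c₃_pos.ne', ENNReal.rpow_one, ENNReal.rpow_one, mul_assoc]

theorem product_const_mul (k₁ k₂ k₃ : ENNReal) (f₁ f₂ f₃ : ℝ → ENNReal) (z : ℝ × ℝ) :
    F.product (fun t => k₁ * f₁ t) (fun t => k₂ * f₂ t) (fun t => k₃ * f₃ t) z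
      = k₁ ^ F.c₁ * k₂ ^ F.c₂ * k₃ ^ F.c₃ * F.product f₁ f₂ f₃ z := by
  have := F.product_mul (fun _ => k₁) (fun _ => k₂) (fun _ => k₃) f₁ f₂ f₃ z
  exact this

variable {F}

namespace IsWeight

variable {μ : Measure ℝ} {w : ℝ → ENNReal}

theorem lintegral_inv_mul {f : ℝ → ENNReal} (hf : Measurable f) (h0 : ∫⁻ t, f t ∂μ ≠ 0)
    (h1 : ∫⁻ t, f t ∂μ ≠ ⊤) : ∫⁻ t, (∫⁻ t, f t ∂μ)⁻¹ * f t ∂μ = 1 := by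
  rw [lintegral_const_mul _ hf, ENNReal.inv_mul_cancel h0 h1]

theorem lintegral_product_eq {f₁ f₂ f₃ : ℝ → ENNReal} (hf₁ : Measurable f₁)
    (hf₂ : Measurable f₂) (hf₃ : Measurable f₃) {k₁ k₂ k₃ : ENNReal} (h₁ : k₁ ≠ 0) (h₁' : k₁ ≠ ⊤)
    (h₂ : k₂ ≠ 0) (h₂' : k₂ ≠ ⊤) (h₃ : k₃ ≠ 0) (h₃' : k₃ ≠ ⊤) :
    ∫⁻ z, F.product f₁ f₂ f₃ z ∂(μ.prod μ) = k₁ ^ F.c₁ * k₂ ^ F.c₂ * k₃ ^ F.c₃ *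
      ∫⁻ z, F.product (fun t => k₁⁻¹ * f₁ t) (fun t => k₂⁻¹ * f₂ t) (fun t => k₃⁻¹ * f₃ t) z
        ∂(μ.prod μ) := by
  rw [← lintegral_const_mul _ (F.measurable_product (by fun_prop) (by fun_prop) (by fun_prop))]
  refine lintegral_congr fun z => ?_
  rw [← F.product_const_mul]
  congr 1 <;> ext t <;> rw [← mul_assoc, ENNReal.mul_inv_cancel ‹_› ‹_›, one_mul]

/-- Homogeneity reduces to functions of mass 1. A function of mass zero cannot be normalized, but it
makes the integrand vanish almost everywhere. -/
theorem lintegral_product_le (W : F.IsWeight μ w) {f₁ f₂ f₃ : ℝ → ENNReal}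
    (hf₁ : Measurable f₁) (hf₂ : Measurable f₂) (hf₃ : Measurable f₃) (hi₁ : ∫⁻ t, f₁ t ∂μ ≠ ⊤)
    (hi₂ : ∫⁻ t, f₂ t ∂μ ≠ ⊤) (hi₃ : ∫⁻ t, f₃ t ∂μ ≠ ⊤) :
    ∫⁻ z, F.product f₁ f₂ f₃ z ∂(μ.prod μ)
      ≤ (∫⁻ t, f₁ t ∂μ) ^ F.c₁ * (∫⁻ t, f₂ t ∂μ) ^ F.c₂ * (∫⁻ t, f₃ t ∂μ) ^ F.c₃ := by
  have zero {u : ℝ × ℝ → ℝ} (hu : Measure.QuasiMeasurePreserving u volume volume)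
      {f : ℝ → ENNReal} (hf : Measurable f) (h : ∫⁻ t, f t ∂μ = 0) :
      ∀ᵐ z ∂(μ.prod μ), f (u z) = 0 := by
    have h1 := (lintegral_eq_zero_iff hf).1 h
    rw [W.prod_eq]
    exact (withDensity_absolutelyContinuous _ _).ae_le
      (hu.ae (W.absolutelyContinuous'.ae_le h1))
  rcases eq_or_ne (∫⁻ t, f₁ t ∂μ) 0 with h₁ | h₁
  · refine le_of_eq_of_le (lintegral_eq_zero_of_ae_eq_zero ?_) zero_le
    have hfst : Measure.QuasiMeasurePreserving (Prod.fst : ℝ × ℝ → ℝ) volume volume := by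
      rw [Measure.volume_eq_prod]; exact Measure.quasiMeasurePreserving_fst
    filter_upwards [zero hfst hf₁ h₁] with z hz
    simp [product, hz, F.c₁_pos]
  rcases eq_or_ne (∫⁻ t, f₂ t ∂μ) 0 with h₂ | h₂
  · refine le_of_eq_of_le (lintegral_eq_zero_of_ae_eq_zero ?_) zero_le
    filter_upwards [zero F.qmp_u₂ hf₂ h₂] with z hz
    simp [product, hz, F.c₂_pos]
  rcases eq_or_ne (∫⁻ t, f₃ t ∂μ) 0 with h₃ | h₃
  · refine le_of_eq_of_le (lintegral_eq_zero_of_ae_eq_zero ?_) zero_le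
    filter_upwards [zero F.qmp_u₃ hf₃ h₃] with z hz
    simp [product, hz, F.c₃_pos]
  rw [lintegral_product_eq hf₁ hf₂ hf₃ h₁ hi₁ h₂ hi₂ h₃ hi₃]
  refine mul_le_of_le_one_right' ?_
  exact (W.lintegral_product_le_one (hf₁.const_mul _) (hf₂.const_mul _) (hf₃.const_mul _)
    (lintegral_inv_mul hf₁ h₁ hi₁) (lintegral_inv_mul hf₂ h₂ hi₂) (lintegral_inv_mul hf₃ h₃ hi₃)).1

variable {A B : ℝ → ENNReal}

theorem lintegral_rpow_mul_lconv_le (W : F.IsWeight μ w) {f : ℝ → ENNReal} (hf : Measurable f)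
    (hA : Measurable A) (hB : Measurable B) (hi : ∫⁻ t, f t ∂μ ≠ ⊤)
    (hiA : ∫⁻ t, A t ^ (1 / F.c₂) ∂μ ≠ ⊤) (hiB : ∫⁻ t, B t ^ (1 / F.c₃) ∂μ ≠ ⊤) :
    ∫⁻ x, f x ^ F.c₁ * F.lconv μ A B x ∂μ ≤ (∫⁻ t, f t ∂μ) ^ F.c₁ *
      ((∫⁻ t, A t ^ (1 / F.c₂) ∂μ) ^ F.c₂ * (∫⁻ t, B t ^ (1 / F.c₃) ∂μ) ^ F.c₃) := by
  have := W.sigmaFinite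
  rw [F.lintegral_rpow_mul_lconv hf hA hB, ← mul_assoc]
  exact W.lintegral_product_le hf (hA.pow_const _) (hB.pow_const _) hi hiA hiB

theorem lintegral_lconv_rpow_le (W : F.IsWeight μ w) (hA : Measurable A) (hB : Measurable B)
    (hiA : ∫⁻ t, A t ^ (1 / F.c₂) ∂μ ≠ ⊤) (hiB : ∫⁻ t, B t ^ (1 / F.c₃) ∂μ ≠ ⊤) :
    ∫⁻ x, F.lconv μ A B x ^ (1 / (1 - F.c₁)) ∂μ ≤
      ((∫⁻ t, A t ^ (1 / F.c₂) ∂μ) ^ F.c₂ * (∫⁻ t, B t ^ (1 / F.c₃) ∂μ) ^ F.c₃)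
        ^ (1 / (1 - F.c₁)) := by
  have := W.sigmaFinite
  exact lintegral_rpow_le_of_forall_lintegral_mul_le (F.measurable_lconv hA hB) F.c₁_pos
    F.c₁_lt_one fun f hf hi => W.lintegral_rpow_mul_lconv_le hf hA hB hi hiA hiB

/-- The extremal pairs of the convolution inequality for nonnegative functions. -/
theorem gaussian_of_lintegral_lconv_rpow_eq (W : F.IsWeight μ w) (hA : Measurable A)
    (hB : Measurable B) (hA0 : ∫⁻ t, A t ^ (1 / F.c₂) ∂μ ≠ 0) (hB0 : ∫⁻ t, B t ^ (1 / F.c₃) ∂μ ≠ 0)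
    (hiA : ∫⁻ t, A t ^ (1 / F.c₂) ∂μ ≠ ⊤) (hiB : ∫⁻ t, B t ^ (1 / F.c₃) ∂μ ≠ ⊤)
    (h : ∫⁻ x, F.lconv μ A B x ^ (1 / (1 - F.c₁)) ∂μ =
      ((∫⁻ t, A t ^ (1 / F.c₂) ∂μ) ^ F.c₂ * (∫⁻ t, B t ^ (1 / F.c₃) ∂μ) ^ F.c₃)
        ^ (1 / (1 - F.c₁))) :
    ∃ v : NNReal, ∃ m₂ m₃ : ℝ, v ≠ 0 ∧
      μ.withDensity (fun t => (∫⁻ t, A t ^ (1 / F.c₂) ∂μ)⁻¹ * A t ^ (1 / F.c₂))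
        = gaussianReal m₂ v ∧
      μ.withDensity (fun t => (∫⁻ t, B t ^ (1 / F.c₃) ∂μ)⁻¹ * B t ^ (1 / F.c₃))
        = gaussianReal m₃ v := by
  have := W.sigmaFinite
  have hc : 0 < 1 - F.c₁ := by linarith [F.c₁_lt_one]
  set a := ∫⁻ t, A t ^ (1 / F.c₂) ∂μ with ha
  set b := ∫⁻ t, B t ^ (1 / F.c₃) ∂μ with hb
  set q := 1 / (1 - F.c₁) with hq
  have hq0 : 0 < q := by positivity
  have hqc : q * F.c₁ + 1 = q := by rw [hq]; field_simp; ring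
  have hadd : ∀ x : ENNReal, x ^ (q * F.c₁) * x = x ^ q := fun x => by
    conv_rhs => rw [← hqc]
    rw [ENNReal.rpow_add_of_nonneg _ _ (mul_nonneg hq0.le F.c₁_pos.le) zero_le_one,
      ENNReal.rpow_one]
  set M := a ^ F.c₂ * b ^ F.c₃ with hM
  have hM0 : M ≠ 0 := mul_ne_zero
    (ENNReal.rpow_pos (pos_iff_ne_zero.2 hA0) hiA).ne'
    (ENNReal.rpow_pos (pos_iff_ne_zero.2 hB0) hiB).ne'
  have hMtop : M ≠ ⊤ := ENNReal.mul_ne_top (ENNReal.rpow_ne_top_of_nonneg F.c₂_pos.le hiA)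
    (ENNReal.rpow_ne_top_of_nonneg F.c₃_pos.le hiB)
  -- The test function for which Hölder is an equality: since `q c₁ + 1 = q`, the pairing is `∫
  -- (lconv) ^ q = M ^ q`. After normalization Brascamp-Lieb is an equality as well.
  set f : ℝ → ENNReal := fun x => F.lconv μ A B x ^ q with hf
  have hfm : Measurable f := (F.measurable_lconv hA hB).pow_const _
  have hMq0 : M ^ q ≠ 0 := (ENNReal.rpow_pos (pos_iff_ne_zero.2 hM0) hMtop).ne'
  have hMqt : M ^ q ≠ ⊤ := ENNReal.rpow_ne_top_of_nonneg hq0.le hMtop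
  have h1 : ∫⁻ x, f x ^ F.c₁ * F.lconv μ A B x ∂μ = M ^ q := by
    rw [← h]
    refine lintegral_congr fun x => ?_
    simp only [hf]
    rw [← ENNReal.rpow_mul, hadd]
  rw [F.lintegral_rpow_mul_lconv hfm hA hB, lintegral_product_eq hfm (hA.pow_const _)
    (hB.pow_const _) hMq0 hMqt hA0 hiA hB0 hiB, mul_assoc ((M ^ q) ^ F.c₁), ← hM,
    ← ENNReal.rpow_mul] at h1
  rw [hadd] at h1
  have h3 := (ENNReal.mul_right_inj hMq0 hMqt).1 (h1.trans (mul_one _).symm)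
  have key := (W.lintegral_product_le_one (hfm.const_mul (M ^ q)⁻¹)
    ((hA.pow_const (1 / F.c₂)).const_mul a⁻¹) ((hB.pow_const (1 / F.c₃)).const_mul b⁻¹)
    (by rw [lintegral_const_mul _ hfm, h, ENNReal.inv_mul_cancel hMq0 hMqt])
    (lintegral_inv_mul (hA.pow_const _) hA0 hiA) (lintegral_inv_mul (hB.pow_const _) hB0 hiB)).2 h3
  obtain ⟨v, m, hv, -, h₂, h₃⟩ := key
  exact ⟨v, _, _, hv, h₂, h₃⟩

/-- Completing the two Gaussians by a third one gives equality in Brascamp-Lieb, and Hölder bounds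
that pairing by the norm of the convolution. -/
theorem le_lintegral_lconv_rpow_of_gaussian (W : F.IsWeight μ w) (hA : Measurable A)
    (hB : Measurable B) (hA0 : ∫⁻ t, A t ^ (1 / F.c₂) ∂μ ≠ 0) (hB0 : ∫⁻ t, B t ^ (1 / F.c₃) ∂μ ≠ 0)
    (hiA : ∫⁻ t, A t ^ (1 / F.c₂) ∂μ ≠ ⊤) (hiB : ∫⁻ t, B t ^ (1 / F.c₃) ∂μ ≠ ⊤)
    {v : NNReal} {m₂ m₃ : ℝ} (hv : v ≠ 0)
    (h₂ : μ.withDensity (fun t => (∫⁻ t, A t ^ (1 / F.c₂) ∂μ)⁻¹ * A t ^ (1 / F.c₂))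
      = gaussianReal m₂ v)
    (h₃ : μ.withDensity (fun t => (∫⁻ t, B t ^ (1 / F.c₃) ∂μ)⁻¹ * B t ^ (1 / F.c₃))
      = gaussianReal m₃ v) :
    ((∫⁻ t, A t ^ (1 / F.c₂) ∂μ) ^ F.c₂ * (∫⁻ t, B t ^ (1 / F.c₃) ∂μ) ^ F.c₃)
        ^ (1 / (1 - F.c₁)) ≤ ∫⁻ x, F.lconv μ A B x ^ (1 / (1 - F.c₁)) ∂μ := by
  have := W.sigmaFinite
  have hc : 0 < 1 - F.c₁ := by linarith [F.c₁_lt_one]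
  -- The centre of the plane Gaussian, determined by its coordinates `m₂` and `m₃` along `u₂` and
  -- `u₃`.
  set m := F.point (F.S₃ * m₂, -(F.S₂ * m₃)) with hm
  have e₂ : m₂ = F.u₂ m := by
    rw [hm, F.u₂_point]; have := F.S₃_pos.ne'; field_simp
  have e₃ : m₃ = F.u₃ m := by
    rw [hm, F.u₃_point]; have := F.S₂_pos.ne'; field_simp
  rw [e₂] at h₂
  rw [e₃] at h₃
  set f : ℝ → ENNReal := fun t => gaussianPDF m.1 v t / w t with hf
  have hfm : Measurable f := (measurable_gaussianPDF _ _).div W.measurable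
  have hfμ : μ.withDensity f = gaussianReal m.1 v := by
    rw [W.withDensity_eq hfm, gaussianReal_of_var_ne_zero _ hv]
    congr 1
    ext t
    exact ENNReal.mul_div_cancel (W.ne_zero t) (W.ne_top t)
  have hf1 : ∫⁻ t, f t ∂μ = 1 := by
    rw [← setLIntegral_univ, ← withDensity_apply _ .univ, hfμ, measure_univ]
  have key : ∫⁻ z, F.product f (fun t => (∫⁻ t, A t ^ (1 / F.c₂) ∂μ)⁻¹ * A t ^ (1 / F.c₂))
      (fun t => (∫⁻ t, B t ^ (1 / F.c₃) ∂μ)⁻¹ * B t ^ (1 / F.c₃)) z ∂(μ.prod μ) = 1 := by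
    rw [← setLIntegral_univ, ← withDensity_apply _ .univ, W.withDensity_product_of_gaussian hfm
      ((hA.pow_const _).const_mul _) ((hB.pow_const _).const_mul _) hv hfμ h₂ h₃, measure_univ]
  have h1 := lintegral_product_eq (F := F) (μ := μ) hfm (hA.pow_const (1 / F.c₂))
    (hB.pow_const (1 / F.c₃)) one_ne_zero ENNReal.one_ne_top hA0 hiA hB0 hiB
  simp only [inv_one, one_mul, ENNReal.one_rpow] at h1
  rw [key, mul_one, ← F.lintegral_rpow_mul_lconv hfm hA hB] at h1
  have hconj : (1 / F.c₁).HolderConjugate (1 / (1 - F.c₁)) := by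
    rw [one_div, one_div]; exact Real.HolderConjugate.inv_one_sub_inv F.c₁_pos F.c₁_lt_one
  have hH := ENNReal.lintegral_mul_le_Lp_mul_Lq μ hconj (f := fun x => f x ^ F.c₁)
    (g := F.lconv μ A B) (hfm.pow_const _).aemeasurable (F.measurable_lconv hA hB).aemeasurable
  have e : ∫⁻ x, (f x ^ F.c₁) ^ (1 / F.c₁) ∂μ = 1 := by
    rw [← hf1]
    refine lintegral_congr fun x => ?_
    rw [← ENNReal.rpow_mul, mul_one_div_cancel F.c₁_pos.ne', ENNReal.rpow_one]
  rw [e, ENNReal.one_rpow, one_mul] at hH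
  simp only [Pi.mul_apply] at hH
  rw [h1, one_div_one_div] at hH
  calc _ ≤ ((∫⁻ x, F.lconv μ A B x ^ (1 / (1 - F.c₁)) ∂μ) ^ (1 - F.c₁)) ^ (1 / (1 - F.c₁)) :=
        ENNReal.rpow_le_rpow hH (by positivity)
    _ = _ := by rw [← ENNReal.rpow_mul, mul_one_div_cancel hc.ne', ENNReal.rpow_one]

end IsWeight

end TightFrame

/-! ### Signs, and Gaussian powers -/

/-- The sign of a real number, with value `1` at `0`. -/
noncomputable def unitSign (x : ℝ) : ℝ := if 0 ≤ x then 1 else -1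

theorem measurable_unitSign : Measurable unitSign :=
  Measurable.ite measurableSet_Ici measurable_const measurable_const

theorem abs_unitSign (x : ℝ) : |unitSign x| = 1 := by
  unfold unitSign; split_ifs <;> simp

theorem unitSign_mul_self (x : ℝ) : unitSign x * x = |x| := by
  unfold unitSign; split_ifs with h
  · rw [abs_of_nonneg h, one_mul]
  · rw [abs_of_neg (not_le.1 h), neg_one_mul]

theorem locallyIntegrable_unitSign_comp {f : ℝ → ℝ} (hf : Measurable f) :
    LocallyIntegrable fun t => unitSign (f t) :=
  (locallyIntegrable_const (1 : ℝ)).mono (measurable_unitSign.comp hf).aestronglyMeasurable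
    (ae_of_all _ fun t => by rw [Real.norm_eq_abs, abs_unitSign, norm_one])

theorem hasConstantSign_of_unitSign {μ : Measure ℝ} {g : ℝ → ℝ}
    (h : (∀ᵐ t ∂μ, 0 ≤ unitSign (g t)) ∨ ∀ᵐ t ∂μ, unitSign (g t) ≤ 0) : HasConstantSign μ g := by
  rcases h with h | h
  · left
    filter_upwards [h] with t ht
    by_contra hn
    rw [unitSign, if_neg hn] at ht
    norm_num at ht
  · right
    filter_upwards [h] with t ht
    by_contra hn
    rw [unitSign, if_pos (not_le.1 hn).le] at ht
    norm_num at ht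

/-- Equality in `|∫ f| ≤ ∫ |f|`. -/
theorem ae_abs_eq_of_abs_integral_eq {α : Type*} [MeasurableSpace α] {μ : Measure α} {f : α → ℝ}
    (hf : Integrable f μ) (h : |∫ x, f x ∂μ| = ∫ x, |f x| ∂μ) :
    ∀ᵐ x ∂μ, |f x| = unitSign (∫ x, f x ∂μ) * f x := by
  set σ := unitSign (∫ x, f x ∂μ) with hσ
  have h0 : ∫ x, (|f x| - σ * f x) ∂μ = 0 := by
    rw [integral_sub hf.abs (hf.const_mul σ), integral_const_mul, hσ, unitSign_mul_self, h, sub_self]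
  have hnn : ∀ x, 0 ≤ |f x| - σ * f x := fun x => by
    have h1 : |σ * f x| = |f x| := by rw [abs_mul, hσ, abs_unitSign, one_mul]
    linarith [le_abs_self (σ * f x)]
  filter_upwards [(integral_eq_zero_iff_of_nonneg hnn (hf.abs.sub (hf.const_mul σ))).1 h0] with x hx
  have : |f x| - σ * f x = 0 := hx
  linarith

/-- The dictionary between the two parametrizations: `λ = 1 / (2v)` and `K = k / √(2πv)`, with `k`
the total mass. -/
theorem ofReal_const_mul_exp_eq {v : NNReal} (hv : v ≠ 0) {k : ENNReal} (hk : k ≠ ⊤) (m : ℝ) :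
    (volume : Measure ℝ).withDensity (fun t => ENNReal.ofReal
      (k.toReal * (√(2 * Real.pi * v))⁻¹ * Real.exp (-(1 / (2 * v)) * (t - m) ^ 2)))
      = k • gaussianReal m v := by
  rw [gaussianReal_of_var_ne_zero _ hv, ← withDensity_smul _ (measurable_gaussianPDF m v)]
  congr 1
  ext t
  rw [Pi.smul_apply, smul_eq_mul, gaussianPDF, gaussianPDFReal, mul_assoc,
    ENNReal.ofReal_mul ENNReal.toReal_nonneg, ENNReal.ofReal_toReal hk]
  congr 4
  field_simp

theorem ofReal_abs_rpow (x : ℝ) {p : ℝ} (hp : 0 < p) :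
    ENNReal.ofReal (|x| ^ p) = ‖x‖ₑ ^ p := by
  rw [← ENNReal.ofReal_rpow_of_nonneg (abs_nonneg x) hp.le, ← Real.enorm_eq_ofReal_abs]

section PowIsGaussian

variable {μ : Measure ℝ} {g : ℝ → ℝ} {p : ℝ}

theorem powIsGaussian_of_eq_gaussianReal (hg : Measurable g) (hp : 0 < p)
    (h0 : ∫⁻ t, ‖g t‖ₑ ^ p ∂μ ≠ 0) (h1 : ∫⁻ t, ‖g t‖ₑ ^ p ∂μ ≠ ⊤) {m : ℝ} {v : NNReal} (hv : v ≠ 0)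
    (h : μ.withDensity (fun t => (∫⁻ t, ‖g t‖ₑ ^ p ∂μ)⁻¹ * ‖g t‖ₑ ^ p) = gaussianReal m v) :
    PowIsGaussian μ g p ((∫⁻ t, ‖g t‖ₑ ^ p ∂μ).toReal * (√(2 * Real.pi * v))⁻¹) (1 / (2 * v)) m := by
  unfold PowIsGaussian
  rw [ofReal_const_mul_exp_eq hv h1, ← h, ← withDensity_smul _ (by fun_prop)]
  congr 1
  ext t
  rw [Pi.smul_apply, smul_eq_mul, ← mul_assoc, ENNReal.mul_inv_cancel h0 h1, one_mul,
    ofReal_abs_rpow _ hp]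

theorem eq_gaussianReal_of_powIsGaussian (hg : Measurable g) (hp : 0 < p) {K lam m : ℝ}
    (hK : 0 < K) (hlam : 0 < lam) (h : PowIsGaussian μ g p K lam m) :
    ∫⁻ t, ‖g t‖ₑ ^ p ∂μ ≠ 0 ∧ μ.withDensity (fun t => (∫⁻ t, ‖g t‖ₑ ^ p ∂μ)⁻¹ * ‖g t‖ₑ ^ p)
      = gaussianReal m (1 / (2 * lam)).toNNReal := by
  set v := (1 / (2 * lam)).toNNReal with hv
  have hvc : (v : ℝ) = 1 / (2 * lam) := Real.coe_toNNReal _ (by positivity)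
  have hvpos : (0 : ℝ) < v := by rw [hvc]; positivity
  have hv0 : v ≠ 0 := by
    rintro h0; rw [h0] at hvpos; exact lt_irrefl _ hvpos
  set k := ENNReal.ofReal (K * √(2 * Real.pi * v)) with hk
  have hkpos : 0 < K * √(2 * Real.pi * v) := by positivity
  have hk0 : k ≠ 0 := by rw [hk, Ne, ENNReal.ofReal_eq_zero, not_le]; exact hkpos
  have h1 : μ.withDensity (fun t => ‖g t‖ₑ ^ p) = k • gaussianReal m v := by
    rw [← ofReal_const_mul_exp_eq hv0 ENNReal.ofReal_ne_top]
    have e : (fun t => ‖g t‖ₑ ^ p) = fun t => ENNReal.ofReal (|g t| ^ p) :=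
      funext fun t => (ofReal_abs_rpow _ hp).symm
    rw [e]
    refine h.trans ?_
    congr 1
    ext t
    rw [ENNReal.toReal_ofReal hkpos.le, hvc, mul_assoc K, mul_inv_cancel₀, mul_one]
    · congr 4; field_simp
    · rw [← hvc]; positivity
  have h2 : ∫⁻ t, ‖g t‖ₑ ^ p ∂μ = k := by
    rw [← setLIntegral_univ, ← withDensity_apply _ .univ, h1, Measure.smul_apply, measure_univ,
      smul_eq_mul, mul_one]
  refine ⟨h2 ▸ hk0, ?_⟩
  have h3 : (fun t => (∫⁻ t, ‖g t‖ₑ ^ p ∂μ)⁻¹ * ‖g t‖ₑ ^ p) = k⁻¹ • fun t => ‖g t‖ₑ ^ p := by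
    rw [h2]; rfl
  rw [h3, withDensity_smul _ (by fun_prop), h1, smul_smul,
    ENNReal.inv_mul_cancel hk0 ENNReal.ofReal_ne_top, one_smul]

end PowIsGaussian

/-! ### The convolution inequality for real functions -/

namespace TightFrame

variable (F : TightFrame)

/-- In the coordinates of `point` the right side depends only on `s + t`, so the multiplicative
Pexider argument applies to each factor in turn. -/
theorem hasConstantSign_of_ae_mul_eq {g h e : ℝ → ℝ} (hg : Measurable g) (hh : Measurable h)
    (he : Measurable e)
    (H : ∀ᵐ z : ℝ × ℝ, unitSign (g (F.u₂ z)) * unitSign (h (F.u₃ z)) = unitSign (e z.1)) :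
    HasConstantSign volume g ∧ HasConstantSign volume h := by
  have hS2 := F.S₂_pos.ne'; have hS3 := F.S₃_pos.ne'
  have key := F.qmp_point.ae H
  simp only [F.u₂_point, F.u₃_point, F.point_fst] at key
  have ne (x : ℝ) : unitSign x ≠ 0 := fun h0 => by simpa [h0] using abs_unitSign x
  have mg : Measurable fun s => g (s / F.S₃) := by fun_prop
  have mh : Measurable fun s => h (-s / F.S₂) := by fun_prop
  have me : Measurable fun s => e (s / F.D) := by fun_prop
  have q₂ := quasiMeasurePreserving_affine 0 hS3
  have q₃ := quasiMeasurePreserving_affine 0 (neg_ne_zero.2 hS2)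
  have e₂ (t : ℝ) : (0 + F.S₃ * t) / F.S₃ = t := by field_simp; ring
  have e₃ (t : ℝ) : -(0 + -F.S₂ * t) / F.S₂ = t := by field_simp; ring
  constructor
  · have := constant_sign_of_ae_mul_eq (G := fun s => unitSign (g (s / F.S₃)))
      (locallyIntegrable_unitSign_comp mh)
      (locallyIntegrable_unitSign_comp me) (ae_of_all _ fun s => abs_unitSign _)
      (ae_of_all _ fun s => ne _) key
    refine hasConstantSign_of_unitSign (this.imp (fun h => ?_) fun h => ?_) <;>
    · filter_upwards [q₂.ae h] with t ht
      rwa [e₂] at ht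
  · have hswap : ∀ᵐ z : ℝ × ℝ, unitSign (h (-z.1 / F.S₂)) * unitSign (g (z.2 / F.S₃))
        = unitSign (e ((z.1 + z.2) / F.D)) := by
      have := (Measure.measurePreserving_swap (μ := (volume : Measure ℝ))
        (ν := (volume : Measure ℝ))).quasiMeasurePreserving.ae key
      filter_upwards [this] with z hz
      rw [mul_comm, add_comm]
      exact hz
    have := constant_sign_of_ae_mul_eq (G := fun s => unitSign (h (-s / F.S₂)))
      (locallyIntegrable_unitSign_comp mg)
      (locallyIntegrable_unitSign_comp me) (ae_of_all _ fun s => abs_unitSign _)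
      (ae_of_all _ fun s => ne _) hswap
    refine hasConstantSign_of_unitSign (this.imp (fun h => ?_) fun h => ?_) <;>
    · filter_upwards [q₃.ae h] with t ht
      rwa [e₃] at ht

/-- The convolution of real functions along the frame. -/
noncomputable def conv (μ : Measure ℝ) (g h : ℝ → ℝ) (x : ℝ) : ℝ :=
  ∫ y, g (F.u₂ (x, y)) * h (F.u₃ (x, y)) ∂μ

theorem measurable_conv {μ : Measure ℝ} [SFinite μ] {g h : ℝ → ℝ} (hg : Measurable g)
    (hh : Measurable h) : Measurable (F.conv μ g h) := by
  have : Measurable fun z : ℝ × ℝ => g (F.u₂ z) * h (F.u₃ z) := by fun_prop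
  exact (this.stronglyMeasurable.integral_prod_right' (ν := μ)).measurable

theorem enorm_conv_le (μ : Measure ℝ) (g h : ℝ → ℝ) (x : ℝ) :
    ‖F.conv μ g h x‖ₑ ≤ F.lconv μ (fun t => ‖g t‖ₑ) (fun t => ‖h t‖ₑ) x := by
  refine (enorm_integral_le_lintegral_enorm _).trans_eq ?_
  simp only [enorm_mul, lconv]

variable {F}

namespace IsWeight

variable {μ : Measure ℝ} {w : ℝ → ENNReal} {g h : ℝ → ℝ}

/-- Because `S₂ ≠ 0`, the slice `y ↦ u₂(x, y)` is a nonsingular affine map for every `x`, not just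
almost every one. -/
theorem ae_u₂ (W : F.IsWeight μ w) {P : ℝ → Prop} (hP : ∀ᵐ t ∂μ, P t) (x : ℝ) :
    ∀ᵐ y ∂μ, P (F.u₂ (x, y)) :=
  W.absolutelyContinuous.ae_le ((quasiMeasurePreserving_affine (F.C₂ * x) F.S₂_pos.ne').ae
    (W.absolutelyContinuous'.ae_le hP))

theorem ae_u₃ (W : F.IsWeight μ w) {P : ℝ → Prop} (hP : ∀ᵐ t ∂μ, P t) (x : ℝ) :
    ∀ᵐ y ∂μ, P (F.u₃ (x, y)) :=
  W.absolutelyContinuous.ae_le ((quasiMeasurePreserving_affine (F.C₃ * x) F.S₃_pos.ne').ae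
    (W.absolutelyContinuous'.ae_le hP))

theorem ae_lconv_lt_top (W : F.IsWeight μ w) {A B : ℝ → ENNReal} (hA : Measurable A)
    (hB : Measurable B) (hiA : ∫⁻ t, A t ^ (1 / F.c₂) ∂μ ≠ ⊤)
    (hiB : ∫⁻ t, B t ^ (1 / F.c₃) ∂μ ≠ ⊤) : ∀ᵐ x ∂μ, F.lconv μ A B x < ⊤ := by
  have := W.sigmaFinite
  have hc : 0 < 1 / (1 - F.c₁) := one_div_pos.2 (by linarith [F.c₁_lt_one])
  have h1 := W.lintegral_lconv_rpow_le hA hB hiA hiB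
  have h2 : ∫⁻ x, F.lconv μ A B x ^ (1 / (1 - F.c₁)) ∂μ ≠ ⊤ :=
    (h1.trans_lt (ENNReal.rpow_lt_top_of_nonneg hc.le (ENNReal.mul_ne_top
      (ENNReal.rpow_ne_top_of_nonneg F.c₂_pos.le hiA)
      (ENNReal.rpow_ne_top_of_nonneg F.c₃_pos.le hiB)))).ne
  filter_upwards [ae_lt_top ((F.measurable_lconv hA hB).pow_const _) h2] with x hx
  exact (ENNReal.rpow_lt_top_iff_of_pos hc).1 hx

theorem integrable_of_lconv_lt_top (hg : Measurable g) (hh : Measurable h) {x : ℝ}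
    (hx : F.lconv μ (fun t => ‖g t‖ₑ) (fun t => ‖h t‖ₑ) x < ⊤) :
    Integrable (fun y => g (F.u₂ (x, y)) * h (F.u₃ (x, y))) μ := by
  refine ⟨Measurable.aestronglyMeasurable (by fun_prop), ?_⟩
  rw [hasFiniteIntegral_iff_enorm]
  simp only [enorm_mul]
  exact hx

/-- Equality in `|∫| ≤ ∫ |·|` for almost every `x` forces the integrand to keep the sign of its
integral, so `sign g(u₂) · sign h(u₃)` is a function of `x` alone. Nonvanishing of `g` and `h` makes
these signs meaningful. -/
theorem hasConstantSign_of_enorm_conv_eq (W : F.IsWeight μ w) (hg : Measurable g)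
    (hh : Measurable h) (hg0 : ∀ᵐ t ∂μ, g t ≠ 0) (hh0 : ∀ᵐ t ∂μ, h t ≠ 0)
    (hlt : ∀ᵐ x ∂μ, F.lconv μ (fun t => ‖g t‖ₑ) (fun t => ‖h t‖ₑ) x < ⊤)
    (heq : ∀ᵐ x ∂μ, ‖F.conv μ g h x‖ₑ = F.lconv μ (fun t => ‖g t‖ₑ) (fun t => ‖h t‖ₑ) x) :
    HasConstantSign μ g ∧ HasConstantSign μ h := by
  have := W.sigmaFinite
  have hcm := F.measurable_conv (μ := μ) hg hh
  have hms : MeasurableSet {z : ℝ × ℝ |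
      unitSign (g (F.u₂ z)) * unitSign (h (F.u₃ z)) = unitSign (F.conv μ g h z.1)} :=
    measurableSet_eq_fun (((measurable_unitSign.comp hg).comp F.measurable_u₂).mul
      ((measurable_unitSign.comp hh).comp F.measurable_u₃))
      ((measurable_unitSign.comp hcm).comp measurable_fst)
  have key : ∀ᵐ z ∂(μ.prod μ),
      unitSign (g (F.u₂ z)) * unitSign (h (F.u₃ z)) = unitSign (F.conv μ g h z.1) := by
    rw [Measure.ae_prod_iff_ae_ae hms]
    filter_upwards [hlt, heq] with x hx hx'
    have hi := integrable_of_lconv_lt_top hg hh hx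
    have h1 : |∫ y, g (F.u₂ (x, y)) * h (F.u₃ (x, y)) ∂μ|
        = ∫ y, |g (F.u₂ (x, y)) * h (F.u₃ (x, y))| ∂μ := by
      have h2 := congrArg ENNReal.toReal hx'
      rw [toReal_enorm, Real.norm_eq_abs] at h2
      change |F.conv μ g h x| = _
      rw [h2]
      have := integral_norm_eq_lintegral_enorm hi.aestronglyMeasurable
      simp only [Real.norm_eq_abs, enorm_mul] at this
      rw [this]; rfl
    filter_upwards [ae_abs_eq_of_abs_integral_eq hi h1, W.ae_u₂ hg0 x, W.ae_u₃ hh0 x]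
      with y hy hy₂ hy₃
    rw [abs_mul, ← unitSign_mul_self, ← unitSign_mul_self] at hy
    refine mul_right_cancel₀ (mul_ne_zero hy₂ hy₃) ?_
    rw [← mul_mul_mul_comm, hy]; rfl
  rw [W.prod_eq] at key
  have hw := W.measurable
  have key' := (withDensity_absolutelyContinuous' (Measurable.aemeasurable (by fun_prop))
    (ae_of_all _ fun z => mul_ne_zero (W.ne_zero _) (W.ne_zero _))).ae_le key
  obtain ⟨h₁, h₂⟩ := F.hasConstantSign_of_ae_mul_eq hg hh hcm key'
  exact ⟨h₁.imp (fun h => W.absolutelyContinuous.ae_le h) fun h => W.absolutelyContinuous.ae_le h,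
    h₂.imp (fun h => W.absolutelyContinuous.ae_le h) fun h => W.absolutelyContinuous.ae_le h⟩

theorem enorm_conv_eq_of_hasConstantSign (W : F.IsWeight μ w) (hg : HasConstantSign μ g)
    (hh : HasConstantSign μ h) {x : ℝ}
    (hi : Integrable (fun y => g (F.u₂ (x, y)) * h (F.u₃ (x, y))) μ) :
    ‖F.conv μ g h x‖ₑ = F.lconv μ (fun t => ‖g t‖ₑ) (fun t => ‖h t‖ₑ) x := by
  have sign {f : ℝ → ℝ} (hf : HasConstantSign μ f) :
      ∃ σ : ℝ, |σ| = 1 ∧ ∀ᵐ t ∂μ, f t = σ * |f t| := by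
    rcases hf with hf | hf
    · exact ⟨1, abs_one, hf.mono fun t ht => by rw [abs_of_nonneg ht, one_mul]⟩
    · exact ⟨-1, by simp, hf.mono fun t ht => by rw [abs_of_nonpos ht]; ring⟩
  obtain ⟨σ, hσ, hg'⟩ := sign hg
  obtain ⟨ρ, hρ, hh'⟩ := sign hh
  have h1 : F.conv μ g h x = σ * ρ * ∫ y, |g (F.u₂ (x, y)) * h (F.u₃ (x, y))| ∂μ := by
    rw [conv, ← integral_const_mul]
    refine integral_congr_ae ?_
    filter_upwards [W.ae_u₂ hg' x, W.ae_u₃ hh' x] with y h₂ h₃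
    rw [abs_mul]
    calc _ = (σ * |g (F.u₂ (x, y))|) * (ρ * |h (F.u₃ (x, y))|) := by rw [← h₂, ← h₃]
      _ = _ := by ring
  have hσ' : ‖σ‖ₑ = 1 := by rw [Real.enorm_eq_ofReal_abs, hσ, ENNReal.ofReal_one]
  have hρ' : ‖ρ‖ₑ = 1 := by rw [Real.enorm_eq_ofReal_abs, hρ, ENNReal.ofReal_one]
  rw [h1, enorm_mul, enorm_mul, hσ', hρ', one_mul, one_mul]
  have h2 := ofReal_integral_norm_eq_lintegral_enorm hi
  simp only [Real.norm_eq_abs, enorm_mul] at h2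
  rw [Real.enorm_of_nonneg (integral_nonneg fun _ => abs_nonneg _), h2]
  rfl

end IsWeight

end TightFrame

theorem eLpNorm_ofReal_one_div {μ : Measure ℝ} {c : ℝ} (hc : 0 < c) (f : ℝ → ℝ) :
    eLpNorm f (ENNReal.ofReal (1 / c)) μ = (∫⁻ t, ‖f t‖ₑ ^ (1 / c) ∂μ) ^ c := by
  have h : 0 < 1 / c := by positivity
  rw [eLpNorm_eq_lintegral_rpow_enorm_toReal (by simpa using hc) ENNReal.ofReal_ne_top,
    ENNReal.toReal_ofReal h.le, one_div_one_div]

theorem HasConstantSign.congr {μ : Measure ℝ} {g g' : ℝ → ℝ} (h : g =ᵐ[μ] g') :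
    HasConstantSign μ g ↔ HasConstantSign μ g' := by
  unfold HasConstantSign
  refine or_congr (Filter.eventually_congr ?_) (Filter.eventually_congr ?_) <;>
  · filter_upwards [h] with t ht
    rw [ht]

theorem PowIsGaussian.congr {μ : Measure ℝ} {g g' : ℝ → ℝ} (h : g =ᵐ[μ] g') {p K lam a : ℝ} :
    PowIsGaussian μ g p K lam a ↔ PowIsGaussian μ g' p K lam a := by
  unfold PowIsGaussian
  rw [withDensity_congr_ae (g := fun t => ENNReal.ofReal (|g' t| ^ p))]
  filter_upwards [h] with t ht
  rw [ht]

namespace TightFrame.IsWeight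

variable {F : TightFrame} {μ : Measure ℝ} {w : ℝ → ENNReal} {g h : ℝ → ℝ}

theorem ae_ne_zero_of_gaussian (W : F.IsWeight μ w) {A : ℝ → ENNReal} (hA : Measurable A)
    {k : ENNReal} {p : ℝ} (hp : 0 < p) {m : ℝ} {v : NNReal} (hv : v ≠ 0)
    (h : μ.withDensity (fun t => k * A t ^ p) = gaussianReal m v) : ∀ᵐ t ∂μ, A t ≠ 0 := by
  filter_upwards [W.absolutelyContinuous.ae_le
    (W.mul_ae_eq_gaussianPDF (by fun_prop) hv h)] with t ht h0
  have := gaussianPDF_pos m hv t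
  rw [← ht] at this
  simp [h0, ENNReal.zero_rpow_of_pos hp] at this

/-- The convolution inequality for measurable functions, with its equality cases. -/
theorem conv_inequality_of_measurable (W : F.IsWeight μ w) (hg : Measurable g) (hh : Measurable h)
    (hgL : MemLp g (ENNReal.ofReal (1 / F.c₂)) μ) (hhL : MemLp h (ENNReal.ofReal (1 / F.c₃)) μ) :
    (∀ᵐ x ∂μ, Integrable (fun y => g (F.u₂ (x, y)) * h (F.u₃ (x, y))) μ) ∧
    MemLp (F.conv μ g h) (ENNReal.ofReal (1 / (1 - F.c₁))) μ ∧
    eLpNorm (F.conv μ g h) (ENNReal.ofReal (1 / (1 - F.c₁))) μ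
      ≤ eLpNorm g (ENNReal.ofReal (1 / F.c₂)) μ * eLpNorm h (ENNReal.ofReal (1 / F.c₃)) μ ∧
    (eLpNorm (F.conv μ g h) (ENNReal.ofReal (1 / (1 - F.c₁))) μ
      = eLpNorm g (ENNReal.ofReal (1 / F.c₂)) μ * eLpNorm h (ENNReal.ofReal (1 / F.c₃)) μ ↔
      (∀ᵐ t ∂μ, g t = 0) ∨ (∀ᵐ t ∂μ, h t = 0) ∨
      (HasConstantSign μ g ∧ HasConstantSign μ h ∧
        ∃ K₂ K₃ lam a₂ a₃ : ℝ, 0 < K₂ ∧ 0 < K₃ ∧ 0 < lam ∧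
          PowIsGaussian μ g (1 / F.c₂) K₂ lam a₂ ∧ PowIsGaussian μ h (1 / F.c₃) K₃ lam a₃)) := by
  have := W.sigmaFinite
  have hc : 0 < 1 - F.c₁ := by linarith [F.c₁_lt_one]
  have hq : 0 < 1 / (1 - F.c₁) := by positivity
  have hp₂ : 0 < 1 / F.c₂ := one_div_pos.2 F.c₂_pos
  have hp₃ : 0 < 1 / F.c₃ := one_div_pos.2 F.c₃_pos
  have hA : Measurable fun t => ‖g t‖ₑ := hg.enorm
  have hB : Measurable fun t => ‖h t‖ₑ := hh.enorm
  have hcm := F.measurable_conv (μ := μ) hg hh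
  have hlm := F.measurable_lconv (μ := μ) hA hB
  have hgn := hgL.eLpNorm_ne_top
  have hhn := hhL.eLpNorm_ne_top
  rw [eLpNorm_ofReal_one_div F.c₂_pos] at hgn ⊢
  rw [eLpNorm_ofReal_one_div F.c₃_pos] at hhn ⊢
  rw [eLpNorm_ofReal_one_div hc]
  have hiA : ∫⁻ t, ‖g t‖ₑ ^ (1 / F.c₂) ∂μ ≠ ⊤ := fun h0 =>
    hgn (by rw [h0, ENNReal.top_rpow_of_pos F.c₂_pos])
  have hiB : ∫⁻ t, ‖h t‖ₑ ^ (1 / F.c₃) ∂μ ≠ ⊤ := fun h0 =>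
    hhn (by rw [h0, ENNReal.top_rpow_of_pos F.c₃_pos])
  have hlt := W.ae_lconv_lt_top hA hB hiA hiB
  have hint : ∀ᵐ x ∂μ, Integrable (fun y => g (F.u₂ (x, y)) * h (F.u₃ (x, y))) μ :=
    hlt.mono fun x hx => integrable_of_lconv_lt_top hg hh hx
  have hmain := W.lintegral_lconv_rpow_le hA hB hiA hiB
  have hle : ∫⁻ x, ‖F.conv μ g h x‖ₑ ^ (1 / (1 - F.c₁)) ∂μ
      ≤ ∫⁻ x, F.lconv μ (fun t => ‖g t‖ₑ) (fun t => ‖h t‖ₑ) x ^ (1 / (1 - F.c₁)) ∂μ :=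
    lintegral_mono fun x => ENNReal.rpow_le_rpow (F.enorm_conv_le μ g h x) hq.le
  set M := (∫⁻ t, ‖g t‖ₑ ^ (1 / F.c₂) ∂μ) ^ F.c₂ * (∫⁻ t, ‖h t‖ₑ ^ (1 / F.c₃) ∂μ) ^ F.c₃ with hM
  have hMt : M ≠ ⊤ := ENNReal.mul_ne_top hgn hhn
  have cancel : ∀ x : ENNReal, (x ^ (1 / (1 - F.c₁))) ^ (1 - F.c₁) = x := fun x => by
    rw [← ENNReal.rpow_mul, one_div_mul_cancel hc.ne', ENNReal.rpow_one]
  have cancel' : ∀ x : ENNReal, (x ^ (1 - F.c₁)) ^ (1 / (1 - F.c₁)) = x := fun x => by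
    rw [← ENNReal.rpow_mul, mul_one_div_cancel hc.ne', ENNReal.rpow_one]
  have hineq : (∫⁻ x, ‖F.conv μ g h x‖ₑ ^ (1 / (1 - F.c₁)) ∂μ) ^ (1 - F.c₁) ≤ M := by
    rw [← cancel M]
    exact ENNReal.rpow_le_rpow (hle.trans hmain) hc.le
  refine ⟨hint, ⟨hcm.aestronglyMeasurable, ?_⟩, hineq, fun heq => ?_, ?_⟩
  · rw [eLpNorm_ofReal_one_div hc]
    exact hineq.trans_lt hMt.lt_top
  · by_cases hA0 : ∫⁻ t, ‖g t‖ₑ ^ (1 / F.c₂) ∂μ = 0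
    · left
      rw [lintegral_eq_zero_iff (by fun_prop)] at hA0
      filter_upwards [hA0] with t ht
      rwa [Pi.zero_apply, ENNReal.rpow_eq_zero_iff_of_pos hp₂, enorm_eq_zero] at ht
    by_cases hB0 : ∫⁻ t, ‖h t‖ₑ ^ (1 / F.c₃) ∂μ = 0
    · right; left
      rw [lintegral_eq_zero_iff (by fun_prop)] at hB0
      filter_upwards [hB0] with t ht
      rwa [Pi.zero_apply, ENNReal.rpow_eq_zero_iff_of_pos hp₃, enorm_eq_zero] at ht
    right; right
    have heq' : ∫⁻ x, ‖F.conv μ g h x‖ₑ ^ (1 / (1 - F.c₁)) ∂μ = M ^ (1 / (1 - F.c₁)) := by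
      rw [← heq, cancel']
    have hl : ∫⁻ x, F.lconv μ (fun t => ‖g t‖ₑ) (fun t => ‖h t‖ₑ) x ^ (1 / (1 - F.c₁)) ∂μ
        = M ^ (1 / (1 - F.c₁)) := le_antisymm hmain (heq' ▸ hle)
    obtain ⟨v, m₂, m₃, hv, h₂, h₃⟩ :=
      W.gaussian_of_lintegral_lconv_rpow_eq hA hB hA0 hB0 hiA hiB hl
    -- `|conv| ≤ lconv` pointwise, and the `q`-th powers have the same finite integral.
    have hconv : ∀ᵐ x ∂μ, ‖F.conv μ g h x‖ₑ = F.lconv μ (fun t => ‖g t‖ₑ) (fun t => ‖h t‖ₑ) x := by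
      have := ae_eq_of_ae_le_of_lintegral_le
        (ae_of_all μ fun x => ENNReal.rpow_le_rpow (F.enorm_conv_le μ g h x) hq.le)
        (by rw [heq']; exact ENNReal.rpow_ne_top_of_nonneg hq.le hMt)
        (hlm.pow_const _).aemeasurable (by rw [hl, heq'])
      filter_upwards [this] with x hx
      rw [← cancel ‖F.conv μ g h x‖ₑ, hx, cancel]
    have hg0 : ∀ᵐ t ∂μ, g t ≠ 0 := (W.ae_ne_zero_of_gaussian hA hp₂ hv h₂).mono fun t ht h0 =>
      ht (by rw [h0, enorm_zero])
    have hh0 : ∀ᵐ t ∂μ, h t ≠ 0 := (W.ae_ne_zero_of_gaussian hB hp₃ hv h₃).mono fun t ht h0 =>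
      ht (by rw [h0, enorm_zero])
    obtain ⟨sg, sh⟩ := W.hasConstantSign_of_enorm_conv_eq hg hh hg0 hh0 hlt hconv
    have hvpos : (0 : ℝ) < v := NNReal.coe_pos.2 (pos_iff_ne_zero.2 hv)
    have pA := ENNReal.toReal_pos hA0 hiA
    have pB := ENNReal.toReal_pos hB0 hiB
    exact ⟨sg, sh, _, _, 1 / (2 * v), m₂, m₃, by positivity, by positivity, by positivity,
      powIsGaussian_of_eq_gaussianReal hg hp₂ hA0 hiA hv h₂,
      powIsGaussian_of_eq_gaussianReal hh hp₃ hB0 hiB hv h₃⟩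
  · rintro (h0 | h0 | ⟨sg, sh, K₂, K₃, lam, a₂, a₃, hK₂, hK₃, hlam, hPg, hPh⟩)
    · have e : ∀ x, F.conv μ g h x = 0 := fun x => integral_eq_zero_of_ae <| by
        filter_upwards [W.ae_u₂ h0 x] with y hy
        rw [hy, zero_mul, Pi.zero_apply]
      have e2 : ∫⁻ t, ‖g t‖ₑ ^ (1 / F.c₂) ∂μ = 0 := lintegral_eq_zero_of_ae_eq_zero <| by
        filter_upwards [h0] with t ht
        rw [ht, enorm_zero, ENNReal.zero_rpow_of_pos hp₂, Pi.zero_apply]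
      rw [hM, e2]
      simp only [e, enorm_zero, ENNReal.zero_rpow_of_pos hq, ENNReal.zero_rpow_of_pos F.c₂_pos,
        lintegral_zero, ENNReal.zero_rpow_of_pos hc, zero_mul]
    · have e : ∀ x, F.conv μ g h x = 0 := fun x => integral_eq_zero_of_ae <| by
        filter_upwards [W.ae_u₃ h0 x] with y hy
        rw [hy, mul_zero, Pi.zero_apply]
      have e2 : ∫⁻ t, ‖h t‖ₑ ^ (1 / F.c₃) ∂μ = 0 := lintegral_eq_zero_of_ae_eq_zero <| by
        filter_upwards [h0] with t ht
        rw [ht, enorm_zero, ENNReal.zero_rpow_of_pos hp₃, Pi.zero_apply]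
      rw [hM, e2]
      simp only [e, enorm_zero, ENNReal.zero_rpow_of_pos hq, ENNReal.zero_rpow_of_pos F.c₃_pos,
        lintegral_zero, ENNReal.zero_rpow_of_pos hc, mul_zero]
    · obtain ⟨hA0, h₂⟩ := eq_gaussianReal_of_powIsGaussian hg hp₂ hK₂ hlam hPg
      obtain ⟨hB0, h₃⟩ := eq_gaussianReal_of_powIsGaussian hh hp₃ hK₃ hlam hPh
      have hv : (1 / (2 * lam)).toNNReal ≠ 0 := by
        rw [Ne, Real.toNNReal_eq_zero, not_le]; positivity
      have hge := W.le_lintegral_lconv_rpow_of_gaussian hA hB hA0 hB0 hiA hiB hv h₂ h₃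
      refine le_antisymm hineq ?_
      rw [← cancel M]
      refine ENNReal.rpow_le_rpow (hge.trans_eq (lintegral_congr_ae ?_)) hc.le
      filter_upwards [hint] with x hx
      rw [W.enorm_conv_eq_of_hasConstantSign sg sh hx]

/-- Borel representatives change neither the hypotheses nor, because the slices are nonsingular, the
value of the convolution at any point. -/
theorem conv_inequality (W : F.IsWeight μ w)
    (hgL : MemLp g (ENNReal.ofReal (1 / F.c₂)) μ) (hhL : MemLp h (ENNReal.ofReal (1 / F.c₃)) μ) :
    (∀ᵐ x ∂μ, Integrable (fun y => g (F.u₂ (x, y)) * h (F.u₃ (x, y))) μ) ∧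
    MemLp (F.conv μ g h) (ENNReal.ofReal (1 / (1 - F.c₁))) μ ∧
    eLpNorm (F.conv μ g h) (ENNReal.ofReal (1 / (1 - F.c₁))) μ
      ≤ eLpNorm g (ENNReal.ofReal (1 / F.c₂)) μ * eLpNorm h (ENNReal.ofReal (1 / F.c₃)) μ ∧
    (eLpNorm (F.conv μ g h) (ENNReal.ofReal (1 / (1 - F.c₁))) μ
      = eLpNorm g (ENNReal.ofReal (1 / F.c₂)) μ * eLpNorm h (ENNReal.ofReal (1 / F.c₃)) μ ↔
      (∀ᵐ t ∂μ, g t = 0) ∨ (∀ᵐ t ∂μ, h t = 0) ∨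
      (HasConstantSign μ g ∧ HasConstantSign μ h ∧
        ∃ K₂ K₃ lam a₂ a₃ : ℝ, 0 < K₂ ∧ 0 < K₃ ∧ 0 < lam ∧
          PowIsGaussian μ g (1 / F.c₂) K₂ lam a₂ ∧ PowIsGaussian μ h (1 / F.c₃) K₃ lam a₃)) := by
  obtain ⟨g', hg'm, hg'⟩ := hgL.1.aemeasurable
  obtain ⟨h', hh'm, hh'⟩ := hhL.1.aemeasurable
  have hslice : ∀ x, (fun y => g (F.u₂ (x, y)) * h (F.u₃ (x, y)))
      =ᵐ[μ] fun y => g' (F.u₂ (x, y)) * h' (F.u₃ (x, y)) := fun x => by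
    filter_upwards [W.ae_u₂ hg' x, W.ae_u₃ hh' x] with y h₂ h₃
    rw [h₂, h₃]
  have hconv : F.conv μ g h = F.conv μ g' h' := funext fun x => integral_congr_ae (hslice x)
  have key := W.conv_inequality_of_measurable hg'm hh'm ((memLp_congr_ae hg').1 hgL)
    ((memLp_congr_ae hh').1 hhL)
  have z {f f' : ℝ → ℝ} (hf : f =ᵐ[μ] f') : (∀ᵐ t ∂μ, f t = 0) ↔ ∀ᵐ t ∂μ, f' t = 0 :=
    Filter.eventually_congr (by filter_upwards [hf] with t ht; rw [ht])
  simp only [fun x => integrable_congr (hslice x), hconv, eLpNorm_congr_ae hg',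
    eLpNorm_congr_ae hh', z hg', z hh', HasConstantSign.congr hg', HasConstantSign.congr hh',
    PowIsGaussian.congr hg', PowIsGaussian.congr hh']
  exact key

end TightFrame.IsWeight

/-! ### The entropy inequality -/

namespace HasFiniteEntropy

variable {Ω E : Type*} [MeasurableSpace Ω] [MeasurableSpace E] {X : Ω → E} {P : Measure Ω}
  [IsProbabilityMeasure P] {ν : Measure E}

theorem integrable_log (h : HasFiniteEntropy X P ν) :
    Integrable (fun ω => Real.log (pdf X P ν (X ω)).toReal) P := by
  have := h.1
  exact (pdf.integrable_pdf_smul_iff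
    (measurable_pdf X P ν).ennreal_toReal.log.aestronglyMeasurable).1 h.2

theorem relEntropy_eq (h : HasFiniteEntropy X P ν) :
    relEntropy X P ν = ∫ ω, Real.log (pdf X P ν (X ω)).toReal ∂P := by
  have := h.1
  exact pdf.integral_pdf_smul (measurable_pdf X P ν).ennreal_toReal.log.aestronglyMeasurable

end HasFiniteEntropy

/-- The law gives no mass to the zero set of its own density, so logarithms along the sample can be
taken of positive numbers. -/
theorem ae_pdf_toReal_pos {Ω E : Type*} [MeasurableSpace Ω] [MeasurableSpace E] (X : Ω → E)
    (P : Measure Ω) [IsProbabilityMeasure P] (ν : Measure E) [HasPDF X P ν] :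
    ∀ᵐ ω ∂P, 0 < (pdf X P ν (X ω)).toReal := by
  have hX : AEMeasurable X P := HasPDF.aemeasurable X P ν
  have h0 : ∀ᵐ x ∂(P.map X), pdf X P ν x ≠ 0 := by
    rw [map_eq_withDensity_pdf X P ν, ae_withDensity_iff (measurable_pdf X P ν)]
    exact ae_of_all _ fun x hx => hx
  have h1 : ∀ᵐ x ∂(P.map X), pdf X P ν x < ⊤ :=
    (HasPDF.absolutelyContinuous : P.map X ≪ ν).ae_le pdf.ae_lt_top
  filter_upwards [ae_of_ae_map hX h0, ae_of_ae_map hX h1] with ω h0 h1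
  exact ENNReal.toReal_pos h0 h1.ne

theorem lintegral_pdf_eq_one {Ω E : Type*} [MeasurableSpace Ω] [MeasurableSpace E] (X : Ω → E)
    (P : Measure Ω) [IsProbabilityMeasure P] (ν : Measure E) [HasPDF X P ν] :
    ∫⁻ x, pdf X P ν x ∂ν = 1 := by
  rw [pdf.lintegral_eq_measure_univ, measure_univ]

namespace TightFrame

variable {F : TightFrame} {Ω : Type*} [MeasurableSpace Ω] {P : Measure Ω} {X Y : Ω → ℝ}

theorem map_u_eq_gaussianReal {a b : ℝ} (hab : a ^ 2 + b ^ 2 = 1) (hX : AEMeasurable X P)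
    (hY : AEMeasurable Y P) (hi : IndepFun X Y P) {m₁ m₂ : ℝ} {v : NNReal}
    (h₁ : P.map X = gaussianReal m₁ v) (h₂ : P.map Y = gaussianReal m₂ v) :
    P.map (fun ω => a * X ω + b * Y ω) = gaussianReal (a * m₁ + b * m₂) v := by
  have hi' : IndepFun (fun ω => a * X ω) (fun ω => b * Y ω) P :=
    hi.comp (measurable_const_mul a) (measurable_const_mul b)
  have e₁ : P.map (fun ω => a * X ω) = gaussianReal (a * m₁) (NNReal.mk (a ^ 2) (sq_nonneg a) * v) := by
    rw [← gaussianReal_map_const_mul, ← h₁,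
      AEMeasurable.map_map_of_aemeasurable (measurable_const_mul a).aemeasurable hX]
    rfl
  have e₂ : P.map (fun ω => b * Y ω) = gaussianReal (b * m₂) (NNReal.mk (b ^ 2) (sq_nonneg b) * v) := by
    rw [← gaussianReal_map_const_mul, ← h₂,
      AEMeasurable.map_map_of_aemeasurable (measurable_const_mul b).aemeasurable hY]
    rfl
  have := gaussianReal_add_gaussianReal_of_indepFun hi' e₁ e₂
  rw [← add_mul] at this
  have e3 : (NNReal.mk (a ^ 2) (sq_nonneg a) + NNReal.mk (b ^ 2) (sq_nonneg b) : NNReal) = 1 := NNReal.eq hab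
  rw [e3, one_mul] at this
  exact this

namespace IsWeight

variable {μ : Measure ℝ} {w : ℝ → ENNReal}

/-- The entropy inequality along the frame, with its equality cases. -/
theorem entropy_inequality [IsProbabilityMeasure P] (W : F.IsWeight μ w)
    (hZ : HasFiniteEntropy (fun ω => (X ω, Y ω)) P (μ.prod μ))
    (hX : HasFiniteEntropy X P μ)
    (hU : HasFiniteEntropy (fun ω => F.u₂ (X ω, Y ω)) P μ)
    (hV : HasFiniteEntropy (fun ω => F.u₃ (X ω, Y ω)) P μ) :
    (F.c₁ * relEntropy X P μ + F.c₂ * relEntropy (fun ω => F.u₂ (X ω, Y ω)) P μ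
      + F.c₃ * relEntropy (fun ω => F.u₃ (X ω, Y ω)) P μ
      ≤ relEntropy (fun ω => (X ω, Y ω)) P (μ.prod μ)) ∧
    (F.c₁ * relEntropy X P μ + F.c₂ * relEntropy (fun ω => F.u₂ (X ω, Y ω)) P μ
      + F.c₃ * relEntropy (fun ω => F.u₃ (X ω, Y ω)) P μ
      = relEntropy (fun ω => (X ω, Y ω)) P (μ.prod μ) ↔
      IndepFun X Y P ∧ ∃ (m₁ m₂ : ℝ) (v : NNReal), v ≠ 0 ∧
        P.map X = gaussianReal m₁ v ∧ P.map Y = gaussianReal m₂ v) := by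
  have := W.sigmaFinite
  have hZp := hZ.1; have hXp := hX.1; have hUp := hU.1; have hVp := hV.1
  have hZm : AEMeasurable (fun ω => (X ω, Y ω)) P := HasPDF.aemeasurable _ P (μ.prod μ)
  have hXm : AEMeasurable X P := HasPDF.aemeasurable X P μ
  have hYm : AEMeasurable Y P := measurable_snd.comp_aemeasurable hZm
  rw [hZ.relEntropy_eq, hX.relEntropy_eq, hU.relEntropy_eq, hV.relEntropy_eq]
  have iZ := hZ.integrable_log; have iX := hX.integrable_log
  have iU := hU.integrable_log; have iV := hV.integrable_log
  have pZ := ae_pdf_toReal_pos (fun ω => (X ω, Y ω)) P (μ.prod μ)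
  have pX := ae_pdf_toReal_pos X P μ
  have pU := ae_pdf_toReal_pos (fun ω => F.u₂ (X ω, Y ω)) P μ
  have pV := ae_pdf_toReal_pos (fun ω => F.u₃ (X ω, Y ω)) P μ
  have fm : Measurable (pdf (fun ω => (X ω, Y ω)) P (μ.prod μ)) := measurable_pdf _ _ _
  have f₁m : Measurable (pdf X P μ) := measurable_pdf _ _ _
  have f₂m : Measurable (pdf (fun ω => F.u₂ (X ω, Y ω)) P μ) := measurable_pdf _ _ _
  have f₃m : Measurable (pdf (fun ω => F.u₃ (X ω, Y ω)) P μ) := measurable_pdf _ _ _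
  have mZ := map_eq_withDensity_pdf (fun ω => (X ω, Y ω)) P (μ.prod μ)
  have mX := map_eq_withDensity_pdf X P μ
  have mU := map_eq_withDensity_pdf (fun ω => F.u₂ (X ω, Y ω)) P μ
  have mV := map_eq_withDensity_pdf (fun ω => F.u₃ (X ω, Y ω)) P μ
  have hBL := W.lintegral_product_le_one f₁m f₂m f₃m (lintegral_pdf_eq_one X P μ)
    (lintegral_pdf_eq_one _ P μ) (lintegral_pdf_eq_one _ P μ)
  have hZlaw : ∀ h : ℝ × ℝ → ENNReal, AEMeasurable h (μ.prod μ) →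
      ∫⁻ z, pdf (fun ω => (X ω, Y ω)) P (μ.prod μ) z * h z ∂(μ.prod μ) = ∫⁻ ω, h (X ω, Y ω) ∂P :=
    fun h hh => pdf.lintegral_pdf_mul hh
  generalize pdf (fun ω => (X ω, Y ω)) P (μ.prod μ) = f at *
  generalize pdf X P μ = f₁ at *
  generalize pdf (fun ω => F.u₂ (X ω, Y ω)) P μ = f₂ at *
  generalize pdf (fun ω => F.u₃ (X ω, Y ω)) P μ = f₃ at *
  have Hm : Measurable (F.product f₁ f₂ f₃) := F.measurable_product f₁m f₂m f₃m
  -- the likelihood ratio of the geometric mean of the marginals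
  set r : ℝ × ℝ → ENNReal := fun z => F.product f₁ f₂ f₃ z / f z with hr
  have rm : Measurable r := Hm.div fm
  have rpos : ∀ᵐ ω ∂P, 0 < (r (X ω, Y ω)).toReal ∧ r (X ω, Y ω) ≠ ⊤ ∧
      Real.log (r (X ω, Y ω)).toReal = F.c₁ * Real.log (f₁ (X ω)).toReal
        + F.c₂ * Real.log (f₂ (F.u₂ (X ω, Y ω))).toReal
        + F.c₃ * Real.log (f₃ (F.u₃ (X ω, Y ω))).toReal
        - Real.log (f (X ω, Y ω)).toReal := by
    filter_upwards [pZ, pX, pU, pV] with ω p p₁ p₂ p₃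
    have e : F.product f₁ f₂ f₃ (X ω, Y ω) = ENNReal.ofReal ((f₁ (X ω)).toReal ^ F.c₁
        * (f₂ (F.u₂ (X ω, Y ω))).toReal ^ F.c₂ * (f₃ (F.u₃ (X ω, Y ω))).toReal ^ F.c₃) :=
      F.ofReal_mul₃_rpow p₁ p₂ p₃
    have hpos : 0 < (f₁ (X ω)).toReal ^ F.c₁
        * (f₂ (F.u₂ (X ω, Y ω))).toReal ^ F.c₂ * (f₃ (F.u₃ (X ω, Y ω))).toReal ^ F.c₃ := by
      positivity
    have ht : (r (X ω, Y ω)).toReal = ((f₁ (X ω)).toReal ^ F.c₁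
        * (f₂ (F.u₂ (X ω, Y ω))).toReal ^ F.c₂ * (f₃ (F.u₃ (X ω, Y ω))).toReal ^ F.c₃)
        / (f (X ω, Y ω)).toReal := by
      rw [hr, ENNReal.toReal_div, e, ENNReal.toReal_ofReal hpos.le]
    refine ⟨by rw [ht]; positivity, ?_, ?_⟩
    · rw [hr]
      exact ENNReal.div_ne_top (by rw [e]; exact ENNReal.ofReal_ne_top)
        (ENNReal.toReal_pos_iff.1 p).1.ne'
    · rw [ht, Real.log_div hpos.ne' p.ne', Real.log_mul (by positivity) (by positivity),
        Real.log_mul (by positivity) (by positivity), Real.log_rpow p₁, Real.log_rpow p₂,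
        Real.log_rpow p₃]
  -- Only an inequality, because the product may have mass where `f` vanishes.
  have hle : ∫⁻ ω, r (X ω, Y ω) ∂P ≤ ∫⁻ z, F.product f₁ f₂ f₃ z ∂(μ.prod μ) := by
    rw [← hZlaw r rm.aemeasurable]
    exact lintegral_mono fun z => ENNReal.mul_div_le
  have hle1 : ∫⁻ ω, r (X ω, Y ω) ∂P ≤ 1 := hle.trans hBL.1
  have rZm : AEMeasurable (fun ω => r (X ω, Y ω)) P := rm.comp_aemeasurable hZm
  have iR : Integrable (fun ω => (r (X ω, Y ω)).toReal) P :=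
    integrable_toReal_of_lintegral_ne_top rZm (hle1.trans_lt ENNReal.one_lt_top).ne
  have eR : ∫ ω, (r (X ω, Y ω)).toReal ∂P = (∫⁻ ω, r (X ω, Y ω) ∂P).toReal :=
    integral_toReal rZm (rpos.mono fun ω h => h.2.1.lt_top)
  have eR1 : ∫ ω, (r (X ω, Y ω)).toReal ∂P ≤ 1 := by
    rw [eR]
    exact ENNReal.toReal_mono ENNReal.one_ne_top hle1
  have iS : Integrable (fun ω => F.c₁ * Real.log (f₁ (X ω)).toReal
      + F.c₂ * Real.log (f₂ (F.u₂ (X ω, Y ω))).toReal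
      + F.c₃ * Real.log (f₃ (F.u₃ (X ω, Y ω))).toReal) P :=
    ((iX.const_mul _).add (iU.const_mul _)).add (iV.const_mul _)
  have eS : ∫ ω, (F.c₁ * Real.log (f₁ (X ω)).toReal
      + F.c₂ * Real.log (f₂ (F.u₂ (X ω, Y ω))).toReal
      + F.c₃ * Real.log (f₃ (F.u₃ (X ω, Y ω))).toReal) ∂P
      = F.c₁ * ∫ ω, Real.log (f₁ (X ω)).toReal ∂P
        + F.c₂ * ∫ ω, Real.log (f₂ (F.u₂ (X ω, Y ω))).toReal ∂P
        + F.c₃ * ∫ ω, Real.log (f₃ (F.u₃ (X ω, Y ω))).toReal ∂P := by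
    have iXU : Integrable (fun ω => F.c₁ * Real.log (f₁ (X ω)).toReal
        + F.c₂ * Real.log (f₂ (F.u₂ (X ω, Y ω))).toReal) P := (iX.const_mul _).add (iU.const_mul _)
    rw [integral_add iXU (iV.const_mul _), integral_add (iX.const_mul _) (iU.const_mul _), integral_const_mul, integral_const_mul,
      integral_const_mul]
  have iL : Integrable (fun ω => Real.log (r (X ω, Y ω)).toReal) P :=
    (iS.sub iZ).congr (rpos.mono fun ω h => h.2.2.symm)
  have eL : ∫ ω, Real.log (r (X ω, Y ω)).toReal ∂P
      = (F.c₁ * ∫ ω, Real.log (f₁ (X ω)).toReal ∂P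
        + F.c₂ * ∫ ω, Real.log (f₂ (F.u₂ (X ω, Y ω))).toReal ∂P
        + F.c₃ * ∫ ω, Real.log (f₃ (F.u₃ (X ω, Y ω))).toReal ∂P)
        - ∫ ω, Real.log (f (X ω, Y ω)).toReal ∂P := by
    rw [← eS, ← integral_sub iS iZ]
    exact integral_congr_ae (rpos.mono fun ω h => h.2.2)
  have iR1 : Integrable (fun ω => (r (X ω, Y ω)).toReal - 1) P := iR.sub (integrable_const 1)
  have iD : Integrable (fun ω => (r (X ω, Y ω)).toReal - 1 - Real.log (r (X ω, Y ω)).toReal) P :=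
    iR1.sub iL
  have eD : ∫ ω, ((r (X ω, Y ω)).toReal - 1 - Real.log (r (X ω, Y ω)).toReal) ∂P
      = ∫ ω, (r (X ω, Y ω)).toReal ∂P - 1 - ∫ ω, Real.log (r (X ω, Y ω)).toReal ∂P := by
    rw [integral_sub iR1 iL, integral_sub iR (integrable_const 1)]
    simp
  -- Integrating `log r ≤ r - 1` gives `E log r ≤ E r - 1 ≤ 0`, which is the inequality; equality
  -- forces `r = 1` almost surely.
  have pD : 0 ≤ᵐ[P] fun ω => (r (X ω, Y ω)).toReal - 1 - Real.log (r (X ω, Y ω)).toReal :=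
    rpos.mono fun ω h => by
      have := Real.log_le_sub_one_of_pos h.1
      simp only [Pi.zero_apply]; linarith
  have hD := integral_nonneg_of_ae pD
  rw [eD] at hD
  refine ⟨by linarith, fun heq => ?_, ?_⟩
  · have hL0 : ∫ ω, Real.log (r (X ω, Y ω)).toReal ∂P = 0 := by rw [eL, heq, sub_self]
    have hR1 : ∫ ω, (r (X ω, Y ω)).toReal ∂P = 1 := by linarith
    have hD0 : ∫ ω, ((r (X ω, Y ω)).toReal - 1 - Real.log (r (X ω, Y ω)).toReal) ∂P = 0 := by
      rw [eD]; linarith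
    have hr1 : ∀ᵐ ω ∂P, r (X ω, Y ω) = 1 := by
      filter_upwards [(integral_eq_zero_iff_of_nonneg_ae pD iD).1 hD0, rpos] with ω h h'
      have h0 : (r (X ω, Y ω)).toReal - 1 - Real.log (r (X ω, Y ω)).toReal = 0 := h
      have h1 : (r (X ω, Y ω)).toReal = 1 := by
        by_contra hne
        have := Real.log_lt_sub_one_of_pos h'.1 hne
        linarith
      exact (ENNReal.toReal_eq_one_iff _).1 h1
    have hprod1 : ∫⁻ z, F.product f₁ f₂ f₃ z ∂(μ.prod μ) = 1 := by
      refine le_antisymm hBL.1 ?_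
      rw [eR, ENNReal.toReal_eq_one_iff] at hR1
      rwa [hR1] at hle
    obtain ⟨v, m, hv, g₁, g₂, g₃⟩ := hBL.2 hprod1
    have hlaw : P.map (fun ω => (X ω, Y ω)) = (gaussianReal m.1 v).prod (gaussianReal m.2 v) := by
      have := Measure.isProbabilityMeasure_map (μ := P) hZm
      -- Where `f ≠ 0` it equals the product, since `r = 1` there, so `f` is at most the product
      -- almost everywhere. Both are probability densities, hence equal.
      refine Measure.eq_of_le_of_isProbabilityMeasure ?_
      rw [← W.withDensity_product_of_gaussian f₁m f₂m f₃m hv g₁ g₂ g₃, mZ]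
      refine withDensity_mono ?_
      have h1 : ∀ᵐ z ∂(P.map fun ω => (X ω, Y ω)), r z = 1 :=
        (ae_map_iff hZm (measurableSet_eq_fun rm measurable_const)).2 hr1
      rw [mZ, ae_withDensity_iff fm] at h1
      filter_upwards [h1] with z hz
      rcases eq_or_ne (f z) 0 with h0 | h0
      · rw [h0]; exact zero_le
      · have := hz h0
        refine le_of_eq ?_
        have h2 : f z * r z ≤ F.product f₁ f₂ f₃ z := ENNReal.mul_div_le
        by_cases ht : f z = ⊤
        · rw [this, mul_one, ht, top_le_iff] at h2; rw [h2, ht]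
        · exact (ENNReal.div_eq_one_iff h0 ht).1 this |>.symm
    have lX : P.map X = gaussianReal m.1 v := by rw [mX, g₁]
    have lY : P.map Y = gaussianReal m.2 v := by
      have : P.map Y = (P.map fun ω => (X ω, Y ω)).map Prod.snd := by
        rw [AEMeasurable.map_map_of_aemeasurable measurable_snd.aemeasurable hZm]; rfl
      rw [this, hlaw]
      exact Measure.snd_prod
    refine ⟨?_, m.1, m.2, v, hv, lX, lY⟩
    rw [indepFun_iff_map_prod_eq_prod_map_map hXm hYm, hlaw, lX, lY]
  · rintro ⟨hi, m₁, m₂, v, hv, lX, lY⟩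
    have lU : P.map (fun ω => F.u₂ (X ω, Y ω)) = gaussianReal (F.u₂ (m₁, m₂)) v :=
      map_u_eq_gaussianReal F.unit₂ hXm hYm hi lX lY
    have lV : P.map (fun ω => F.u₃ (X ω, Y ω)) = gaussianReal (F.u₃ (m₁, m₂)) v :=
      map_u_eq_gaussianReal F.unit₃ hXm hYm hi lX lY
    have hlaw := (indepFun_iff_map_prod_eq_prod_map_map hXm hYm).1 hi
    rw [lX, lY, ← W.withDensity_product_of_gaussian f₁m f₂m f₃m (m := (m₁, m₂)) hv (mX ▸ lX)
      (mU ▸ lU) (mV ▸ lV), mZ, withDensity_eq_iff_of_sigmaFinite fm.aemeasurable Hm.aemeasurable]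
      at hlaw
    have hlaw' : ∀ᵐ ω ∂P, f (X ω, Y ω) = F.product f₁ f₂ f₃ (X ω, Y ω) := by
      refine ae_of_ae_map hZm (p := fun z => f z = F.product f₁ f₂ f₃ z) ?_
      rw [mZ]
      exact (withDensity_absolutelyContinuous _ _).ae_le hlaw
    have hL0 : ∫ ω, Real.log (r (X ω, Y ω)).toReal ∂P = 0 := by
      refine integral_eq_zero_of_ae ?_
      filter_upwards [hlaw', pZ] with ω h p
      obtain ⟨h0, ht⟩ := ENNReal.toReal_pos_iff.1 p
      simp only [hr]
      rw [← h, ENNReal.div_self h0.ne' ht.ne, ENNReal.toReal_one, Real.log_one, Pi.zero_apply]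
    rw [eL] at hL0
    linarith

end IsWeight

end TightFrame

/-! ### The angles and their frame -/

section Angles

variable {p₁ p₂ p₃ : ℝ}

theorem mul_mul_eq_of_sum_inv_eq_two (hp₁ : 1 < p₁) (hp₂ : 1 < p₂) (hp₃ : 1 < p₃)
    (hp : 1 / p₁ + 1 / p₂ + 1 / p₃ = 2) :
    p₂ * p₃ + p₁ * p₃ + p₁ * p₂ = 2 * (p₁ * p₂ * p₃) := by
  have h₁ : p₁ ≠ 0 := by positivity
  have h₂ : p₂ ≠ 0 := by positivity
  have h₃ : p₃ ≠ 0 := by positivity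
  field_simp at hp
  linarith

theorem existsUnique_angle {a b : ℝ} (hb : 0 < b) (h : a ^ 2 + b ^ 2 = 1) :
    ∃! θ : ℝ, θ ∈ Set.Ioo 0 Real.pi ∧ Real.cos θ = a ∧ Real.sin θ = b := by
  have ha : -1 < a ∧ a < 1 := abs_lt.1 ((sq_lt_one_iff_abs_lt_one a).1 (by nlinarith))
  have hcos : Real.cos (Real.arccos a) = a := Real.cos_arccos ha.1.le ha.2.le
  refine ⟨Real.arccos a, ⟨⟨Real.arccos_pos.2 ha.2, ?_⟩, hcos, ?_⟩, fun θ hθ => ?_⟩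
  · refine lt_of_le_of_ne (Real.arccos_le_pi a) fun h0 => ?_
    rw [h0, Real.cos_pi] at hcos
    linarith [ha.1]
  · rw [Real.sin_arccos, show 1 - a ^ 2 = b ^ 2 by linarith, Real.sqrt_sq hb.le]
  · rw [← hθ.2.1, Real.arccos_cos hθ.1.1.le hθ.1.2.le]

theorem sqrt_sq_add_sqrt_sq (hp₁ : 1 < p₁) (hp₂ : 1 < p₂) (hp₃ : 1 < p₃)
    (hp : 1 / p₁ + 1 / p₂ + 1 / p₃ = 2) :
    √((p₁ - 1) * (p₂ - 1)) ^ 2 + √(p₁ * p₂ * (p₃ - 1) / p₃) ^ 2 = 1 := by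
  have h := mul_mul_eq_of_sum_inv_eq_two hp₁ hp₂ hp₃ hp
  have h₁ : 0 < p₁ - 1 := by linarith
  have h₂ : 0 < p₂ - 1 := by linarith
  have h₃ : 0 < p₃ - 1 := by linarith
  have h₃' : p₃ ≠ 0 := by positivity
  rw [Real.sq_sqrt (by positivity), Real.sq_sqrt (by positivity)]
  field_simp
  linear_combination -h

theorem existsUnique_isSecondAngle (hp₁ : 1 < p₁) (hp₂ : 1 < p₂) (hp₃ : 1 < p₃)
    (hp : 1 / p₁ + 1 / p₂ + 1 / p₃ = 2) : ∃! θ : ℝ, IsSecondAngle p₁ p₂ p₃ θ := by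
  have h₃ : 0 < p₃ - 1 := by linarith
  exact existsUnique_angle (Real.sqrt_pos.2 (by positivity)) (sqrt_sq_add_sqrt_sq hp₁ hp₂ hp₃ hp)

theorem existsUnique_isThirdAngle (hp₁ : 1 < p₁) (hp₂ : 1 < p₂) (hp₃ : 1 < p₃)
    (hp : 1 / p₁ + 1 / p₂ + 1 / p₃ = 2) : ∃! θ : ℝ, IsThirdAngle p₁ p₂ p₃ θ := by
  have h₂ : 0 < p₂ - 1 := by linarith
  refine existsUnique_angle (Real.sqrt_pos.2 (by positivity)) ?_
  rw [neg_sq]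
  exact sqrt_sq_add_sqrt_sq hp₁ hp₃ hp₂ (by linarith)

/-- The frame of the three directions `(1, 0)`, `(cos θ₂, sin θ₂)`, `(cos θ₃, sin θ₃)`, with
weights `1 / pᵢ`. -/
noncomputable def angleFrame (hp₁ : 1 < p₁) (hp₂ : 1 < p₂) (hp₃ : 1 < p₃)
    (hp : 1 / p₁ + 1 / p₂ + 1 / p₃ = 2) {θ₂ θ₃ : ℝ} (hθ₂ : IsSecondAngle p₁ p₂ p₃ θ₂)
    (hθ₃ : IsThirdAngle p₁ p₂ p₃ θ₃) : TightFrame :=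
  have h := mul_mul_eq_of_sum_inv_eq_two hp₁ hp₂ hp₃ hp
  have h₁ : 0 < p₁ - 1 := by linarith
  have h₂ : 0 < p₂ - 1 := by linarith
  have h₃ : 0 < p₃ - 1 := by linarith
  have h₁' : p₁ ≠ 0 := by positivity
  have h₂' : p₂ ≠ 0 := by positivity
  have h₃' : p₃ ≠ 0 := by positivity
  have C₂sq : Real.cos θ₂ ^ 2 = (p₁ - 1) * (p₂ - 1) := by
    rw [hθ₂.2.1, Real.sq_sqrt (by positivity)]
  have C₃sq : Real.cos θ₃ ^ 2 = (p₁ - 1) * (p₃ - 1) := by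
    rw [hθ₃.2.1, neg_sq, Real.sq_sqrt (by positivity)]
  have S₂sq : Real.sin θ₂ ^ 2 = p₁ * p₂ * (p₃ - 1) / p₃ := by
    rw [hθ₂.2.2, Real.sq_sqrt (by positivity)]
  have S₃sq : Real.sin θ₃ ^ 2 = p₁ * p₃ * (p₂ - 1) / p₂ := by
    rw [hθ₃.2.2, Real.sq_sqrt (by positivity)]
  have C₂pos : 0 < Real.cos θ₂ := by rw [hθ₂.2.1]; exact Real.sqrt_pos.2 (by positivity)
  have S₂pos : 0 < Real.sin θ₂ := by rw [hθ₂.2.2]; exact Real.sqrt_pos.2 (by positivity)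
  have C₃neg : Real.cos θ₃ < 0 := by
    rw [hθ₃.2.1]; exact neg_neg_of_pos (Real.sqrt_pos.2 (by positivity))
  have S₃pos : 0 < Real.sin θ₃ := by rw [hθ₃.2.2]; exact Real.sqrt_pos.2 (by positivity)
  { c₁ := 1 / p₁
    c₂ := 1 / p₂
    c₃ := 1 / p₃
    C₂ := Real.cos θ₂
    S₂ := Real.sin θ₂
    C₃ := Real.cos θ₃
    S₃ := Real.sin θ₃
    c₁_pos := by positivity
    c₂_pos := by positivity
    c₃_pos := by positivity
    c₁_lt_one := by rw [div_lt_one (by positivity)]; exact hp₁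
    c₂_lt_one := by rw [div_lt_one (by positivity)]; exact hp₂
    c₃_lt_one := by rw [div_lt_one (by positivity)]; exact hp₃
    S₂_pos := S₂pos
    S₃_pos := S₃pos
    C₂_pos := C₂pos
    C₃_neg := C₃neg
    unit₂ := Real.cos_sq_add_sin_sq θ₂
    unit₃ := Real.cos_sq_add_sin_sq θ₃
    diag₁ := by
      rw [C₂sq, C₃sq]; field_simp; linear_combination (p₁ - 1) * -h
    offdiag := by
      -- The two terms have equal squares; they cancel because `cos θ₂ > 0 > cos θ₃` while both
      -- sines are positive.
      have e : (1 / p₂ * Real.cos θ₂ * Real.sin θ₂) ^ 2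
          = (1 / p₃ * -Real.cos θ₃ * Real.sin θ₃) ^ 2 := by
        rw [mul_pow, mul_pow, mul_pow, mul_pow, neg_sq, C₂sq, C₃sq, S₂sq, S₃sq]
        field_simp
      have := (sq_eq_sq₀ (by positivity) (mul_nonneg (mul_nonneg (by positivity)
        (neg_nonneg.2 C₃neg.le)) S₃pos.le)).1 e
      linarith
    diag₂ := by
      rw [S₂sq, S₃sq]; field_simp; linear_combination -h }

end Angles

/-! ### The two dual statements -/

theorem mainTheorem1 (μ : Measure ℝ) (hμ : μ = volume ∨ μ = gaussianReal 0 1)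
    (p₁ p₂ p₃ : ℝ) (hp₁ : 1 < p₁) (hp₂ : 1 < p₂) (hp₃ : 1 < p₃)
    (hp : 1 / p₁ + 1 / p₂ + 1 / p₃ = 2) :
    (∃! θ₂ : ℝ, IsSecondAngle p₁ p₂ p₃ θ₂) ∧
    (∃! θ₃ : ℝ, IsThirdAngle p₁ p₂ p₃ θ₃) ∧
    ∀ θ₂ θ₃ : ℝ, IsSecondAngle p₁ p₂ p₃ θ₂ → IsThirdAngle p₁ p₂ p₃ θ₃ →
      -- the entropy inequality and its equality cases
      (∀ (Ω : Type*) [MeasurableSpace Ω] (P : Measure Ω) [IsProbabilityMeasure P]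
        (X Y : Ω → ℝ),
        HasFiniteEntropy (fun ω => (X ω, Y ω)) P (μ.prod μ) →
        HasFiniteEntropy X P μ →
        HasFiniteEntropy (fun ω => Real.cos θ₂ * X ω + Real.sin θ₂ * Y ω) P μ →
        HasFiniteEntropy (fun ω => Real.cos θ₃ * X ω + Real.sin θ₃ * Y ω) P μ →
        (1 / p₁ * relEntropy X P μ
            + 1 / p₂ * relEntropy (fun ω => Real.cos θ₂ * X ω + Real.sin θ₂ * Y ω) P μ
            + 1 / p₃ * relEntropy (fun ω => Real.cos θ₃ * X ω + Real.sin θ₃ * Y ω) P μ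
          ≤ relEntropy (fun ω => (X ω, Y ω)) P (μ.prod μ)) ∧
        (1 / p₁ * relEntropy X P μ
            + 1 / p₂ * relEntropy (fun ω => Real.cos θ₂ * X ω + Real.sin θ₂ * Y ω) P μ
            + 1 / p₃ * relEntropy (fun ω => Real.cos θ₃ * X ω + Real.sin θ₃ * Y ω) P μ
          = relEntropy (fun ω => (X ω, Y ω)) P (μ.prod μ) ↔
          IndepFun X Y P ∧ ∃ (m₁ m₂ : ℝ) (v : NNReal), v ≠ 0 ∧
            P.map X = gaussianReal m₁ v ∧ P.map Y = gaussianReal m₂ v)) ∧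
      -- the integral inequality and its equality cases
      (∀ g h : ℝ → ℝ, MemLp g (ENNReal.ofReal p₂) μ → MemLp h (ENNReal.ofReal p₃) μ →
        (∀ᵐ x ∂μ, Integrable (fun y =>
          g (Real.cos θ₂ * x + Real.sin θ₂ * y) * h (Real.cos θ₃ * x + Real.sin θ₃ * y)) μ) ∧
        MemLp (angleConv μ θ₂ θ₃ g h) (ENNReal.ofReal (p₁ / (p₁ - 1))) μ ∧
        (eLpNorm (angleConv μ θ₂ θ₃ g h) (ENNReal.ofReal (p₁ / (p₁ - 1))) μ
          ≤ eLpNorm g (ENNReal.ofReal p₂) μ * eLpNorm h (ENNReal.ofReal p₃) μ) ∧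
        (eLpNorm (angleConv μ θ₂ θ₃ g h) (ENNReal.ofReal (p₁ / (p₁ - 1))) μ
          = eLpNorm g (ENNReal.ofReal p₂) μ * eLpNorm h (ENNReal.ofReal p₃) μ ↔
          (∀ᵐ t ∂μ, g t = 0) ∨ (∀ᵐ t ∂μ, h t = 0) ∨
          (HasConstantSign μ g ∧ HasConstantSign μ h ∧
            ∃ K₂ K₃ lam a₂ a₃ : ℝ, 0 < K₂ ∧ 0 < K₃ ∧ 0 < lam ∧
              PowIsGaussian μ g p₂ K₂ lam a₂ ∧ PowIsGaussian μ h p₃ K₃ lam a₃))) := by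
  refine ⟨existsUnique_isSecondAngle hp₁ hp₂ hp₃ hp, existsUnique_isThirdAngle hp₁ hp₂ hp₃ hp,
    fun θ₂ θ₃ hθ₂ hθ₃ => ?_⟩
  have hp₁0 : p₁ - 1 ≠ 0 := by linarith
  have hp₁1 : p₁ ≠ 0 := by positivity
  let F := angleFrame hp₁ hp₂ hp₃ hp hθ₂ hθ₃
  obtain ⟨w, W⟩ : ∃ w, F.IsWeight μ w := by
    rcases hμ with rfl | rfl
    · exact ⟨_, F.isWeight_volume⟩
    · exact ⟨_, F.isWeight_gaussianReal⟩
  refine ⟨fun Ω _ P _ X Y hZ hX hU hV => W.entropy_inequality hZ hX hU hV, fun g h hg hh => ?_⟩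
  have e₁ : 1 / (1 - F.c₁) = p₁ / (p₁ - 1) := by
    change 1 / (1 - 1 / p₁) = _
    field_simp
  have e₂ : 1 / F.c₂ = p₂ := one_div_one_div p₂
  have e₃ : 1 / F.c₃ = p₃ := one_div_one_div p₃
  have key := W.conv_inequality (g := g) (h := h) (by rwa [e₂]) (by rwa [e₃])
  rw [e₁, e₂, e₃] at key
  exact key
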